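/- Let $E$ be a $d$-dimensional real Euclidean space with dual $E^*$. A $d$-dimensional FBS-complex $(B,E,\rho)$ consists of a finite $d$-dimensional semi-simplicial set $B$ ($B_d\neq\varnothing$, $B_n=\varnothing$ for $n>d$) and a homomorphism $\rho:C_1(B,\mathbb Z)\to E$ that vanishes on boundaries and is such that for each $s\in B_d$ the vectors $\rho(e_{d,1}(s)),\dots,\rho(e_{d,d}(s))$ are linearly independent; here $e_{n,i}(s)$ is the edge of $s\in B_n$ from vertex $0$ to vertex $i$. Let $|B|$ be the geometric realization, $|s|\subset|B|$ the open cell of $s$, and let $\alpha_s:|s|\to E$ send the point with barycentric coordinates $(t_0,\dots,t_n)$ to $\sum_{i=1}^n t_i\,\rho(e_{n,i}(s))$. An isometric winding is a continuous map $f:E\to|B|$ such that, for every simplex $s$, $f$ restricts to a covering map $f^{-1}(|s|)\to|s|$ (with empty fibres allowed) and $\alpha_s\circ f$ is a translation on each connected component of $f^{-1}(|s|)$. For an isometric winding $f_0$, its hull $\mathbb X(f_0)$ is the closure of $\{T_tf_0: t\in E\}$, $T_tf(y)=f(y-t)$, in the compact-open topology of $C(E,|B|)$. Let $\mu$ be a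 translation-invariant Borel probability measure on $\mathbb X(f_0)$, and let $\psi_k\in L^2(\mathbb X(f_0),\mu)$ be a normalized eigenfunction with eigenvalue $k\in E^*$: $\psi_k(T_{-t}f)=e^{2\pi i k\cdot t}\psi_k(f)$ for $\mu$-almost all $f$, for every $t\in E$. For $x\in|B|$ and a Schwartz function $\varphi\in\mathcal S(E)$ put $\Gamma_x(\varphi)(f)=\sum_{y\in f^{-1}(x)}\varphi(-y)$ and $\widehat\varphi(k)=\int_E\varphi(y)e^{-2\pi i k\cdot y}\,dy$. The partial amplitudes are the function $a_k:|B|\to\mathbb C$ characterized by $$\langle\psi_k,\Gamma_x(\varphi)\rangle=a_k(x)\,\widehat\varphi(k)\qquad(x\in|B|,\ \varphi\in\mathcal S(E));$$ the sums $\Gamma_x(\varphi)(f)$ converge absolutely, $\Gamma_x(\varphi)\in L^2(\mathbb X(f_0),\mu)$, and $a_k$ exists and is unique. Moreover, for all sites $x_1,\dots,x_m\in|B|$: if $\zeta=(\zeta_{pq})$ is a matrix-valued diffraction measure of these sites, i.e. a positive semi-definite tempered matrix-valued measure on $E^*$ with $\langle\Gamma_{x_p}(\varphi_1),\Gamma_{x_q}(\varphi_2)\rangle=\int\overline{\widehat{\varphi_1}}\,\widehat{\varphi_2}\,d\zeta_{pq}$,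 and $\Theta:L^2(E^*,\zeta;\mathbb C^m)\to L^2(\mathbb X(f_0),\mu)$ is the linear isometric embedding with $\Theta(\widehat\varphi\otimes e_p)=\Gamma_{x_p}(\varphi)$, then $\langle\psi_k,\Theta(1_{\{k\}}\otimes e_p)\rangle=a_k(x_p)$. For $k\in E^*$ let $\mathcal F_{(k),n}$ be the complex vector space with basis $Y_s$, $s\in B_n$ (the function $Y_s(x)=e^{-2\pi i k\cdot\alpha_s(x)}$ on $|s|$, $0$ elsewhere), with face operators $\delta_{n,i}Y_s=e^{-2\pi i k\cdot t_{s,i}}Y_{\delta_{n,i}s}$, where $t_{s,0}=\rho(e_{n,1}(s))$ and $t_{s,i}=0$ for $i\ne0$, and boundary operator $\partial_n=\sum_{i=0}^n(-1)^i\delta_{n,i}$. **Corollary.** Let $(B,E,\rho)$ be a $d$-dimensional FBS-complex, $k\in E^*$, and $x_1,\dots,x_m\in|B|$. Let $r=\operatorname{rank}H_d(\mathcal F_{(k),\bullet},\partial_\bullet)$. There are at least $m-r$ linearly independent linear constraints, depending only on $(B,E,\rho)$, $k$ and $x_1,\dots,x_m$, that the partial amplitudes satisfy: there exist linearly independent vectors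 $c_1,\dots,c_{\max(m-r,0)}\in\mathbb C^m$ such that for every isometric winding $f_0$, every translation-invariant Borel probability measure $\mu$ on $\mathbb X(f_0)$ and every normalized eigenfunction $\psi_k$ with eigenvalue $k$, $$\sum_{p=1}^m c_{j,p}\,a_k(x_p)=0\qquad\text{for all } j.$$ -/

import Mathlib

open CategoryTheory MeasureTheory Topology
open scoped SchwartzMap ENNReal ComplexOrder

universe u

noncomputable section

/-! ### Semi-simplicial sets and their geometric realization -/

/-- A semi-simplicial set: a contravariant functor from the category of the finite ordinals `[n]`
and their injective monotone maps to sets. -/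
abbrev SemiSimplicialSet : Type (u + 1) := SemiSimplexCategoryᵒᵖ ⥤ Type u

namespace SemiSimplicialSet

variable (B : SemiSimplicialSet.{u})

/-- The set `B_n` of `n`-dimensional simplices. -/
def Cell (n : ℕ) : Type u := B.obj (Opposite.op (SemiSimplexCategory.mk n))

/-- The map `B_n → B_m` induced by an injective monotone map `[m] → [n]`. -/
def pull {m n : ℕ} (φ : Fin (m + 1) ↪o Fin (n + 1)) (s : B.Cell n) : B.Cell m :=
  B.map (Quiver.Hom.op (X := SemiSimplexCategory.mk m) (Y := SemiSimplexCategory.mk n)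
    (SemiSimplexCategory.homEquiv.symm φ)) s

/-- The face map `δ_{n+1,i} : B_{n+1} → B_n`, induced by the injection missing `i`. -/
def face {n : ℕ} (i : Fin (n + 2)) (s : B.Cell (n + 1)) : B.Cell n :=
  B.pull (Fin.succAboveOrderEmb i) s

/-- The injection `[1] → [n]` with `0 ↦ 0` and `1 ↦ i + 1`, where `i < n`. -/
def edgeEmb {n : ℕ} (i : Fin n) : Fin (1 + 1) ↪o Fin (n + 1) :=
  OrderEmbedding.ofStrictMono ![0, i.succ] (by
    intro a b h
    fin_cases a <;> fin_cases b <;> simp_all)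

/-- The reference edge `e_{n,i+1} : B_n → B_1`, joining the vertices `0` and `i + 1`. -/
def edge {n : ℕ} (i : Fin n) (s : B.Cell n) : B.Cell 1 := B.pull (edgeEmb i) s

/-- The disjoint union of one closed standard simplex for each simplex of `B`. -/
abbrev Pre : Type u := Σ c : (Σ n : ℕ, B.Cell n), stdSimplex ℝ (Fin (c.1 + 1))

/-- The gluing: a point of the simplex attached to the face `φ^* s` is identified with its image
in the simplex attached to `s`. -/
inductive Glue : B.Pre → B.Pre → Prop
  | mk {m n : ℕ} (φ : Fin (m + 1) ↪o Fin (n + 1)) (s : B.Cell n)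
      (t : stdSimplex ℝ (Fin (m + 1))) :
      Glue ⟨⟨m, B.pull φ s⟩, t⟩ ⟨⟨n, s⟩, stdSimplex.map φ t⟩

/-- The geometric realization `|B|`, with the quotient topology. -/
def Realization : Type u := Quot B.Glue

instance : TopologicalSpace B.Realization := inferInstanceAs (TopologicalSpace (Quot B.Glue))

variable {B}

/-- The point of `|B|` with barycentric coordinates `t` in the closed cell of `s`. -/
def point {n : ℕ} (s : B.Cell n) (t : stdSimplex ℝ (Fin (n + 1))) : B.Realization :=
  Quot.mk _ ⟨⟨n, s⟩, t⟩

/-- The open cell `|s| ⊆ |B|`. -/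
def openCell {n : ℕ} (s : B.Cell n) : Set B.Realization :=
  {x | ∃ t : stdSimplex ℝ (Fin (n + 1)), (∀ i, 0 < t i) ∧ point s t = x}

end SemiSimplicialSet

/-! ### Flat-branched semi-simplicial complexes and isometric windings -/

/-- A `d`-dimensional flat-branched semi-simplicial complex `(B, E, ρ)`. -/
structure FBSComplex (E : Type*) [NormedAddCommGroup E] [InnerProductSpace ℝ E] (d : ℕ) where
  /-- the semi-simplicial set `B` -/
  B : SemiSimplicialSet.{u}
  finite_cell : ∀ n, Finite (B.Cell n)
  nonempty_cell : Nonempty (B.Cell d)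
  isEmpty_cell : ∀ n, d < n → IsEmpty (B.Cell n)
  finrank_eq : Module.finrank ℝ E = d
  /-- the homomorphism `ρ : C_1(B, ℤ) → E` -/
  ρ : (B.Cell 1 →₀ ℤ) →+ E
  ρ_boundary : ∀ s : B.Cell 2,
    ρ (Finsupp.single (B.face 0 s) 1 - Finsupp.single (B.face 1 s) 1
      + Finsupp.single (B.face 2 s) 1) = 0
  linearIndependent : ∀ s : B.Cell d,
    LinearIndependent ℝ fun i : Fin d => ρ (Finsupp.single (B.edge i s) 1)

namespace FBSComplex

variable {E : Type*} [NormedAddCommGroup E] [InnerProductSpace ℝ E] {d : ℕ}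
  (K : FBSComplex.{u} E d)

/-- The prototile space `|B|`. -/
abbrev Space : Type u := K.B.Realization

/-- The vector `ρ(e_{n,i+1}(s))`. -/
def edgeVec {n : ℕ} (s : K.B.Cell n) (i : Fin n) : E := K.ρ (Finsupp.single (K.B.edge i s) 1)

/-- The map `α_s`, in barycentric coordinates: `t ↦ ∑_{i ≥ 1} t_i ρ(e_{n,i}(s))`. -/
def position {n : ℕ} (s : K.B.Cell n) (t : stdSimplex ℝ (Fin (n + 1))) : E :=
  ∑ i : Fin n, t i.succ • K.edgeVec s i

/-- Isometric windings: over each open cell `|s|` the map `f` restricts to a covering map, and on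
each connected component of `f⁻¹(|s|)` the composition `α_s ∘ f` is a translation. -/
structure IsIsometricWinding (f : C(E, K.Space)) : Prop where
  covering : ∀ (n : ℕ) (s : K.B.Cell n),
    IsCoveringMap (Set.restrictPreimage (SemiSimplicialSet.openCell s) f)
  translation : ∀ (n : ℕ) (s : K.B.Cell n), ∀ y₀ ∈ f ⁻¹' SemiSimplicialSet.openCell s,
    ∃ v : E, ∀ y ∈ connectedComponentIn (f ⁻¹' SemiSimplicialSet.openCell s) y₀,
      ∀ t : stdSimplex ℝ (Fin (n + 1)), (∀ i, 0 < t i) → SemiSimplicialSet.point s t = f y →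
        K.position s t = y + v

/-! ### The semi-simplicial vector space attached to a wave vector and its homology -/

/-- The vector `t_{s,i}`: it is `ρ(e_{n+1,1}(s))` if `i = 0`, and `0` otherwise. -/
def faceShift {n : ℕ} (s : K.B.Cell (n + 1)) (i : Fin (n + 2)) : E :=
  if i = 0 then K.edgeVec s 0 else 0

/-- The space `𝓕_{(k),n}`, expressed in its basis `Y_s`, `s ∈ B_n`, where `Y_s : |B| → ℂ` is
`x ↦ exp(-2πi k(α_s(x)))` on `|s|` and `0` elsewhere (these functions are linearly
independent). -/
def F (_k : E →L[ℝ] ℝ) (n : ℕ) : Type u := K.B.Cell n →₀ ℂ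

instance (k : E →L[ℝ] ℝ) (n : ℕ) : AddCommGroup (K.F k n) :=
  inferInstanceAs (AddCommGroup (K.B.Cell n →₀ ℂ))

instance (k : E →L[ℝ] ℝ) (n : ℕ) : Module ℂ (K.F k n) :=
  inferInstanceAs (Module ℂ (K.B.Cell n →₀ ℂ))

/-- The basis vector `Y_s` of `𝓕_{(k),n}`. -/
def Y (k : E →L[ℝ] ℝ) {n : ℕ} (s : K.B.Cell n) : K.F k n :=
  (Finsupp.single s 1 : K.B.Cell n →₀ ℂ)

/-- The face operator `Y_s ↦ exp(-2πi k(t_{s,i})) Y_{δ_i s}`. -/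
def faceF (k : E →L[ℝ] ℝ) (n : ℕ) (i : Fin (n + 2)) : K.F k (n + 1) →ₗ[ℂ] K.F k n :=
  Finsupp.linearCombination ℂ fun s : K.B.Cell (n + 1) =>
    Complex.exp (-2 * Real.pi * Complex.I * (k (K.faceShift s i) : ℂ)) • K.Y k (K.B.face i s)

/-- The boundary operator `∂_{n+1} = ∑_i (-1)^i δ_{n+1,i}`. -/
def boundary (k : E →L[ℝ] ℝ) (n : ℕ) : K.F k (n + 1) →ₗ[ℂ] K.F k n :=
  ∑ i : Fin (n + 2), (-1 : ℂ) ^ (i : ℕ) • K.faceF k n i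

/-- The `n`-cycles, that is the kernel of `∂_n` (where `∂_0 = 0`). -/
def cycles (k : E →L[ℝ] ℝ) : (n : ℕ) → Submodule ℂ (K.F k n)
  | 0 => ⊤
  | n + 1 => LinearMap.ker (K.boundary k n)

/-- The homology `H_n(𝓕_{(k),•}, ∂_•)`: cycles modulo boundaries. -/
def Homology (k : E →L[ℝ] ℝ) (n : ℕ) : Type u :=
  K.cycles k n ⧸ (LinearMap.range (K.boundary k n)).submoduleOf (K.cycles k n)

instance (k : E →L[ℝ] ℝ) (n : ℕ) : AddCommGroup (K.Homology k n) :=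
  inferInstanceAs (AddCommGroup (K.cycles k n ⧸ _))

instance (k : E →L[ℝ] ℝ) (n : ℕ) : Module ℂ (K.Homology k n) :=
  inferInstanceAs (Module ℂ (K.cycles k n ⧸ _))

/-! ### The hull -/

variable {K}

/-- The translation `(T_t f)(y) = f(y - t)`. -/
def translate (t : E) (f : C(E, K.Space)) : C(E, K.Space) :=
  f.comp ⟨fun y => y - t, by fun_prop⟩

/-- The hull `𝕏(f₀)`: the closure of the translation orbit in the compact-open topology. -/
def Hull (f₀ : C(E, K.Space)) : Type _ :=
  ↥(closure (Set.range fun t : E => translate t f₀))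

instance (f₀ : C(E, K.Space)) : TopologicalSpace (Hull f₀) :=
  inferInstanceAs (TopologicalSpace ↥(closure (Set.range fun t : E => translate t f₀)))

instance (f₀ : C(E, K.Space)) : MeasurableSpace (Hull f₀) := borel _

instance (f₀ : C(E, K.Space)) : BorelSpace (Hull f₀) := ⟨rfl⟩

theorem translate_mem_hull {f₀ : C(E, K.Space)} (t : E) {f : C(E, K.Space)}
    (hf : f ∈ closure (Set.range fun t : E => translate t f₀)) :
    translate t f ∈ closure (Set.range fun t : E => translate t f₀) := by
  have hc : Continuous (translate t : C(E, K.Space) → C(E, K.Space)) :=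
    ContinuousMap.continuous_precomp _
  refine map_mem_closure hc hf ?_
  rintro _ ⟨u, rfl⟩
  refine ⟨t + u, ?_⟩
  ext y
  simp only [translate, ContinuousMap.comp_apply, ContinuousMap.coe_mk]
  congr 1
  abel

/-- The translation `T_t` as a self-map of the hull. -/
def Hull.shift {f₀ : C(E, K.Space)} (t : E) (f : Hull f₀) : Hull f₀ :=
  ⟨translate t f.1, translate_mem_hull t f.2⟩

/-! ### Partial diffraction amplitudes -/

/-- `Γ_x(φ) : f ↦ ∑_{y ∈ f⁻¹(x)} φ(-y)`. -/
def Gam {f₀ : C(E, K.Space)} (x : K.Space) (φ : 𝓢(E, ℂ)) (f : Hull f₀) : ℂ :=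
  ∑' y : f.1 ⁻¹' {x}, φ (-(y : E))

/-- `ψ` is a normalized eigenfunction with eigenvalue `k`: `T_t ψ = exp(2πi k(t)) ψ` for all `t`,
where `(T_t ψ)(f) = ψ(T_{-t} f)`. -/
def IsEigenfunction {f₀ : C(E, K.Space)} (μ : Measure (Hull f₀)) (k : E →L[ℝ] ℝ)
    (ψ : Lp ℂ 2 μ) : Prop :=
  ‖ψ‖ = 1 ∧ ∀ t : E, ∀ᵐ f ∂μ,
    ψ (Hull.shift (-t) f) = Complex.exp (2 * Real.pi * Complex.I * (k t : ℂ)) * ψ f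

variable [FiniteDimensional ℝ E] [MeasurableSpace E] [BorelSpace E]

/-- The Fourier transform `φ̂(κ) = ∫ φ(y) exp(-2πi κ(y)) dy`, as a function on the dual of `E`. -/
def fourierDual (φ : 𝓢(E, ℂ)) (κ : E →L[ℝ] ℝ) : ℂ :=
  ∫ y, Complex.exp (-2 * Real.pi * Complex.I * (κ y : ℂ)) * φ y

end FBSComplex

/-- A tempered measure on the dual of `E` with values in the positive semi-definite Hermitian
`m × m` matrices. It is presented by a matrix density with respect to a scalar positive measure,
for instance its trace: `ζ_{pq} = density_{pq} · base`. -/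
structure TemperedMatrixMeasure (E : Type*) [NormedAddCommGroup E] [InnerProductSpace ℝ E]
    (m : ℕ) where
  base : Measure (E →L[ℝ] ℝ)
  density : (E →L[ℝ] ℝ) → Matrix (Fin m) (Fin m) ℂ
  measurable_density : ∀ p q, Measurable fun κ => density κ p q
  posSemidef : ∀ κ, (density κ).PosSemidef
  tempered : ∃ N : ℕ,
    Integrable (fun κ => ((1 + ‖κ‖) ^ N)⁻¹ * (density κ).trace.re) base

namespace TemperedMatrixMeasure

variable {E : Type*} [NormedAddCommGroup E] [InnerProductSpace ℝ E] {m : ℕ}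

/-- The squared norm of `g` in `L²(E^*, ζ; ℂ^m)`, namely `∫ g^* dζ g`. -/
def normSq (ζ : TemperedMatrixMeasure E m) (g : (E →L[ℝ] ℝ) → Fin m → ℂ) : ℝ≥0∞ :=
  ∫⁻ κ, ENNReal.ofReal (dotProduct (star (g κ)) ((ζ.density κ).mulVec (g κ))).re ∂ζ.base

/-- `g` represents an element of `L²(E^*, ζ; ℂ^m)`. -/
def MemL2 (ζ : TemperedMatrixMeasure E m) (g : (E →L[ℝ] ℝ) → Fin m → ℂ) : Prop :=
  Measurable g ∧ ζ.normSq g < ∞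

end TemperedMatrixMeasure

namespace FBSComplex

variable {E : Type*} [NormedAddCommGroup E] [InnerProductSpace ℝ E] [FiniteDimensional ℝ E]
  [MeasurableSpace E] [BorelSpace E] {d : ℕ} {K : FBSComplex.{u} E d} {f₀ : C(E, K.Space)}

/-- `ζ` is the matrix-valued diffraction measure of the sites `x_1, …, x_m`. -/
def IsDiffractionMeasure (μ : Measure (Hull f₀)) {m : ℕ} (x : Fin m → K.Space)
    (ζ : TemperedMatrixMeasure E m) : Prop :=
  ∀ (p q : Fin m) (φ₁ φ₂ : 𝓢(E, ℂ)),
    ∫ f, star (Gam (x p) φ₁ f) * Gam (x q) φ₂ f ∂μ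
      = ∫ κ, star (fourierDual φ₁ κ) * fourierDual φ₂ κ * ζ.density κ p q ∂ζ.base

/-- `Θ` is the linear isometric embedding `L²(E^*, ζ; ℂ^m) → L²(𝕏(f₀), μ)` that sends
`φ̂ ⊗ e_p` to `Γ_{x_p}(φ)`. It is given on representatives, and its values at functions that are
not square-integrable play no role. -/
structure IsSpectralEmbedding (μ : Measure (Hull f₀)) {m : ℕ} (x : Fin m → K.Space)
    (ζ : TemperedMatrixMeasure E m) (Θ : ((E →L[ℝ] ℝ) → Fin m → ℂ) → Lp ℂ 2 μ) : Prop where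
  map_add : ∀ g h, ζ.MemL2 g → ζ.MemL2 h → Θ (g + h) = Θ g + Θ h
  map_smul : ∀ (c : ℂ) (g), ζ.MemL2 g → Θ (c • g) = c • Θ g
  isometry : ∀ g, ζ.MemL2 g → ENNReal.ofReal (‖Θ g‖ ^ 2) = ζ.normSq g
  schwartz : ∀ (φ : 𝓢(E, ℂ)) (p : Fin m),
    Θ (fun κ => Pi.single p (fourierDual φ κ)) =ᵐ[μ] Gam (x p) φ

open Classical in
/-- `a : |B| → ℂ` is the function of partial diffraction amplitudes of the dynamical system
`(𝕏(f₀), E, μ)` for the eigenfunction `ψ` with eigenvalue `k`: the functions `Γ_x(φ)` are well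
defined elements of `L²`, `⟨ψ, Γ_x(φ)⟩ = a(x) φ̂(k)`, and `⟨ψ, Θ(1_{k} ⊗ e_p)⟩ = a(x_p)` for every
choice of sites. -/
structure IsPartialAmplitude (μ : Measure (Hull f₀)) (k : E →L[ℝ] ℝ) (ψ : Lp ℂ 2 μ)
    (a : K.Space → ℂ) : Prop where
  summable : ∀ (x : K.Space) (φ : 𝓢(E, ℂ)) (f : Hull f₀),
    Summable fun y : f.1 ⁻¹' {x} => φ (-(y : E))
  memLp : ∀ (x : K.Space) (φ : 𝓢(E, ℂ)), MemLp (Gam (f₀ := f₀) x φ) 2 μ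
  integral_eq : ∀ (x : K.Space) (φ : 𝓢(E, ℂ)),
    ∫ f, star (ψ f) * Gam x φ f ∂μ = a x * fourierDual φ k
  spectral_eq : ∀ (m : ℕ) (x : Fin m → K.Space) (ζ : TemperedMatrixMeasure E m)
    (Θ : ((E →L[ℝ] ℝ) → Fin m → ℂ) → Lp ℂ 2 μ),
    IsDiffractionMeasure μ x ζ → IsSpectralEmbedding μ x ζ Θ →
      ∀ p, inner ℂ ψ (Θ fun κ => Pi.single p (if κ = k then 1 else 0)) = a (x p)

end FBSComplex

end

noncomputable section

/-! An isometric winding is a tiling of `E` by translates of the top-dimensional simplices, and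
every function in its hull inherits this property. Fix a direction `w` parallel to no wall. Every
`y` in `E` then lies in exactly one closed tile into which `w` points from `y`. Hence the fibre over
`x` splits according to the finitely many representations `(s, t)` of `x` in top-dimensional closed
cells into which `w` points (`directed`), and each class is a translate by `α_s(t)` of the set of
tiles of type `s`.

A sum over tiles is an integral over `E` of a bounded measurable kernel (`IsTiled.hasSum_smear`).
Fubini, the invariance of the measure and the eigenvalue equation give `⟨ψ, ∑_u h(-u)⟩ = A_s ĥ(k)`,
where `A_s` is the tile amplitude `amplitude k ψ s` (`integral_star_mul_smear`). Thus `a_k(x)` is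
the sum of `A_s exp(-2πi k(α_s(t)))` over the directed representations of `x`, a linear function of
the numbers `A_s`.

Since `a_k` is unique, `w` and `-w` give the same value. At a point in the open cell of a
codimension-one simplex `τ`, this equates the contributions from the two sides of the wall. A
determinant identity (`det_cons_edgeVec_face`) turns the side on which a tile lies into the face
sign `(-1)^j` times the orientation sign of `s`, so that the chain with coefficients `sgn(orient s)
A_s` is a cycle (`sum_faces_eq_zero`). As there are no cells of dimension `d + 1`, the cycles are
`H_d`, of dimension `r`. The vector of the `a_k(x_p)` therefore lies in the image of an
`r`-dimensional space under a map built from `K`, `k`, `w` and the sites only. The functionals that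
vanish on this image are the constraints. -/

theorem stdSimplex_map_apply_of_injective {m n : ℕ} {φ : Fin m → Fin n} (hφ : φ.Injective)
    (t : stdSimplex ℝ (Fin m)) (i : Fin m) : stdSimplex.map φ t (φ i) = t i := by
  rw [stdSimplex.map_coe, FunOnFinite.linearMap_apply_apply]
  rw [Finset.sum_eq_single i]
  · intro b hb hbi
    exact absurd (hφ (by simpa using hb)) hbi
  · simp

theorem stdSimplex_map_apply_of_notMem_range {m n : ℕ} {φ : Fin m → Fin n}
    (t : stdSimplex ℝ (Fin m)) {j : Fin n} (hj : j ∉ Set.range φ) : stdSimplex.map φ t j = 0 := by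
  rw [stdSimplex.map_coe, FunOnFinite.linearMap_apply_apply]
  refine Finset.sum_eq_zero fun i hi => absurd ⟨i, by simpa using hi⟩ hj

theorem stdSimplex_continuous_apply {n : ℕ} (j : Fin n) :
    Continuous fun t : stdSimplex ℝ (Fin n) => t j :=
  (continuous_apply j).comp continuous_subtype_val

/-! ### Geometric realization: separating functions, open cells and topology -/

namespace SemiSimplicialSet

variable {B : SemiSimplicialSet.{u}}

theorem pull_pull {l m n : ℕ} (φ : Fin (l + 1) ↪o Fin (m + 1)) (ψ : Fin (m + 1) ↪o Fin (n + 1))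
    (s : B.Cell n) : B.pull φ (B.pull ψ s) = B.pull (φ.trans ψ) s := by
  have h : SemiSimplexCategory.homEquiv.symm (φ.trans ψ) =
      (SemiSimplexCategory.homEquiv (n := SemiSimplexCategory.mk l)
        (m := SemiSimplexCategory.mk m)).symm φ ≫
      (SemiSimplexCategory.homEquiv (n := SemiSimplexCategory.mk m)
        (m := SemiSimplexCategory.mk n)).symm ψ := by
    apply SemiSimplexCategory.hom_ext
    rw [SemiSimplexCategory.homEquiv_comp]
    simp only [Equiv.apply_symm_apply]
  unfold pull
  rw [h]
  change _ = B.map (_ ≫ _) s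
  rw [B.map_comp]
  rfl

theorem pull_id {n : ℕ} (s : B.Cell n) : B.pull (RelEmbedding.refl _) s = s :=
  ConcreteCategory.congr_hom (B.map_id (Opposite.op (SemiSimplexCategory.mk n))) s

theorem point_pull {m n : ℕ} (φ : Fin (m + 1) ↪o Fin (n + 1)) (s : B.Cell n)
    (t : stdSimplex ℝ (Fin (m + 1))) : point (B.pull φ s) t = point s (stdSimplex.map φ t) :=
  Quot.sound (Glue.mk φ s t)

theorem continuous_point {n : ℕ} (s : B.Cell n) : Continuous (point s) :=
  continuous_quot_mk.comp (continuous_sigmaMk (σ := fun c : (Σ n : ℕ, B.Cell n) =>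
    stdSimplex ℝ (Fin (c.1 + 1))) (i := ⟨n, s⟩))

instance (m n : ℕ) : Fintype (Fin m ↪o Fin n) := Fintype.ofFinite _

open Classical in
/-- The function on the closed cells whose value at the point with barycentric coordinates `t` of
the closed cell of `s'` is `∑_φ (∏ᵢ t_{φ i}) t_{φ j}`, where `φ` runs over the injections with
`φ^* s' = s`. -/
def preBump {n : ℕ} (s : B.Cell n) (j : Fin (n + 1)) (p : B.Pre) : ℝ :=
  ∑ φ : Fin (n + 1) ↪o Fin (p.1.1 + 1),
    if B.pull φ p.1.2 = s then (∏ i, p.2 (φ i)) * p.2 (φ j) else 0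

/-- An injection into the larger simplex that misses the face `ψ` at some vertex picks up a
vanishing coordinate, so the product kills its term. The remaining injections factor through `ψ` and
match those of the face. Summing over all injections is necessary because a cell may have `s` as a
face in several ways. -/
theorem preBump_eq_of_glue {n : ℕ} (s : B.Cell n) (j : Fin (n + 1)) (p q : B.Pre)
    (h : B.Glue p q) : preBump s j p = preBump s j q := by
  classical
  obtain ⟨ψ, s', t⟩ := h
  refine Fintype.sum_of_injective (fun φ => φ.trans ψ) ?_ _ _ ?_ ?_
  · intro φ φ' h
    ext i
    have := DFunLike.congr_fun h i
    simpa [Fin.ext_iff] using this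
  · intro φ hφ
    dsimp only at φ hφ ⊢
    have : ∃ i, φ i ∉ Set.range ψ := by
      by_contra! hall
      choose g hg using hall
      refine hφ ⟨OrderEmbedding.ofMapLEIff g fun a b => ?_, ?_⟩
      · rw [← ψ.le_iff_le, hg, hg, φ.le_iff_le]
      · ext i
        simp [hg]
    obtain ⟨i, hi⟩ := this
    have h0 : ∏ i, stdSimplex.map ψ t (φ i) = 0 :=
      Finset.prod_eq_zero (Finset.mem_univ i) (stdSimplex_map_apply_of_notMem_range t hi)
    rw [h0, zero_mul, ite_self]
  · intro φ
    dsimp only at φ ⊢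
    have h (i) : stdSimplex.map ψ t (ψ (φ i)) = t (φ i) :=
      stdSimplex_map_apply_of_injective ψ.injective t (φ i)
    have h' : B.pull φ (B.pull ψ s') = B.pull (φ.trans ψ) s' := pull_pull φ ψ s'
    simp only [RelEmbedding.coe_trans, Function.comp_apply, h]
    exact if_congr (iff_of_eq (congrArg (· = s) h')) rfl rfl

/-- The continuous function `∏ᵢ tᵢ · t_j` of the open cell of `s`, extended to `|B|`. -/
def bump {n : ℕ} (s : B.Cell n) (j : Fin (n + 1)) : B.Realization → ℝ :=
  Quot.lift (preBump s j) (preBump_eq_of_glue s j)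

open Classical in
theorem continuous_bump {n : ℕ} (s : B.Cell n) (j : Fin (n + 1)) : Continuous (bump s j) := by
  refine continuous_quot_lift _ (continuous_sigma fun c => ?_)
  have : ∀ φ : Fin (n + 1) ↪o Fin (c.1 + 1), Continuous fun t : stdSimplex ℝ (Fin (c.1 + 1)) =>
      if B.pull φ c.2 = s then (∏ i, t (φ i)) * t (φ j) else 0 := fun φ => ?_
  · exact continuous_finsetSum Finset.univ fun φ _ => this φ
  split_ifs
  · exact (continuous_finsetProd _ fun i _ => stdSimplex_continuous_apply _).mul
      (stdSimplex_continuous_apply _)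
  · exact continuous_const

open Classical in
theorem bump_point {m n : ℕ} (s : B.Cell n) (j : Fin (n + 1)) (s' : B.Cell m)
    (t : stdSimplex ℝ (Fin (m + 1))) : bump s j (point s' t) =
      ∑ φ : Fin (n + 1) ↪o Fin (m + 1),
        if B.pull φ s' = s then (∏ i, t (φ i)) * t (φ j) else 0 := rfl

theorem orderEmbedding_eq_refl {n : ℕ} (φ : Fin (n + 1) ↪o Fin (n + 1)) :
    φ = RelEmbedding.refl _ := by
  have h := Subsingleton.elim (RelIso.ofSurjective φ
    (Finite.surjective_of_injective φ.injective)) (OrderIso.refl (Fin (n + 1)))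
  ext i
  exact congrArg Fin.val (DFunLike.congr_fun h i)

open Classical in
theorem bump_point_same {n : ℕ} (s s' : B.Cell n) (j : Fin (n + 1))
    (t : stdSimplex ℝ (Fin (n + 1))) :
    bump s j (point s' t) = if s' = s then (∏ i, t i) * t j else 0 := by
  rw [bump_point, Finset.sum_eq_single (RelEmbedding.refl _)]
  · rw [pull_id]; rfl
  · intro φ _ h
    exact absurd (orderEmbedding_eq_refl φ) h
  · simp

theorem le_of_bump_ne_zero {m n : ℕ} {s : B.Cell n} {j : Fin (n + 1)} {s' : B.Cell m}
    {t : stdSimplex ℝ (Fin (m + 1))} (h : bump s j (point s' t) ≠ 0) : n ≤ m := by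
  rw [bump_point] at h
  obtain ⟨φ, -, -⟩ := Finset.exists_ne_zero_of_sum_ne_zero h
  simpa using Fintype.card_le_of_embedding φ.toEmbedding

theorem bump_point_pos {n : ℕ} (s : B.Cell n) (j : Fin (n + 1))
    {t : stdSimplex ℝ (Fin (n + 1))} (ht : ∀ i, 0 < t i) : 0 < bump s j (point s t) := by
  rw [bump_point_same, if_pos rfl]
  exact mul_pos (Finset.prod_pos fun i _ => ht i) (ht j)

theorem exists_map_eq {n : ℕ} (t : stdSimplex ℝ (Fin (n + 1))) :
    ∃ (m : ℕ) (φ : Fin (m + 1) ↪o Fin (n + 1)) (t' : stdSimplex ℝ (Fin (m + 1))),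
      (∀ i, 0 < t' i) ∧ stdSimplex.map φ t' = t := by
  classical
  set S : Finset (Fin (n + 1)) := Finset.univ.filter fun i => t i ≠ 0 with hS
  have hcard : ∃ m, S.card = m + 1 := by
    refine Nat.exists_eq_succ_of_ne_zero fun h => ?_
    have h0 : ∀ i, t i = 0 := by
      intro i
      by_contra hi
      have : i ∈ S := by simp [hS, hi]
      rw [Finset.card_eq_zero.mp h] at this
      simp at this
    have := stdSimplex.sum_eq_one t
    simp [h0] at this
  obtain ⟨m, hm⟩ := hcard
  have hsum : ∑ i, t (S.orderEmbOfFin hm i) = 1 := by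
    rw [← stdSimplex.sum_eq_one t]
    refine Fintype.sum_of_injective (S.orderEmbOfFin hm) (S.orderEmbOfFin hm).injective _ _ ?_
      fun i => rfl
    intro i hi
    rw [Finset.range_orderEmbOfFin] at hi
    by_contra h
    exact hi (by simp [hS, h])
  refine ⟨m, S.orderEmbOfFin hm, ⟨fun i => t (S.orderEmbOfFin hm i),
    fun i => stdSimplex.zero_le t _, hsum⟩, fun i => ?_, ?_⟩
  · have : S.orderEmbOfFin hm i ∈ S := Finset.orderEmbOfFin_mem _ _ _
    exact lt_of_le_of_ne (stdSimplex.zero_le t _) ((Finset.mem_filter.mp this).2).symm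
  · refine stdSimplex.ext (funext fun j => ?_)
    by_cases hj : j ∈ Set.range (S.orderEmbOfFin hm)
    · obtain ⟨i, rfl⟩ := hj
      rw [stdSimplex_map_apply_of_injective (S.orderEmbOfFin hm).injective]
      rfl
    · rw [stdSimplex_map_apply_of_notMem_range _ hj]
      rw [Finset.range_orderEmbOfFin] at hj
      by_contra h
      exact hj (by simpa [hS, eq_comm] using h)

theorem exists_point_eq (x : B.Realization) :
    ∃ (n : ℕ) (s : B.Cell n) (t : stdSimplex ℝ (Fin (n + 1))), (∀ i, 0 < t i) ∧ point s t = x := by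
  obtain ⟨⟨⟨n, s⟩, t⟩, rfl⟩ := Quot.exists_rep x
  obtain ⟨m, φ, t', ht', rfl⟩ := exists_map_eq t
  exact ⟨m, B.pull φ s, t', ht', point_pull φ s t'⟩

/-- The barycentric coordinates on the open cell of `s`. -/
def coord {n : ℕ} (s : B.Cell n) (j : Fin (n + 1)) (x : B.Realization) : ℝ :=
  bump s j x / ∑ i, bump s i x

/-- On the open cell the bumps are `(∏ t_i) t_j`, and their sum over `j` is `∏ t_i`, so the quotient
recovers `t_j`. -/
theorem coord_point {n : ℕ} (s : B.Cell n) (j : Fin (n + 1))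
    {t : stdSimplex ℝ (Fin (n + 1))} (ht : ∀ i, 0 < t i) : coord s j (point s t) = t j := by
  have hp : (0 : ℝ) < ∏ i, t i := Finset.prod_pos fun i _ => ht i
  simp only [coord, bump_point_same, if_true, ← Finset.mul_sum, stdSimplex.sum_eq_one, mul_one]
  field_simp

/-- The bump of a point's own cell does not vanish there. Comparing in both directions gives equal
dimensions, then equal cells, and the quotients `coord` give equal coordinates. Separation of points
by continuous functions is what makes `|B|` Hausdorff. -/
theorem eq_of_bump_eq {x y : B.Realization}
    (h : ∀ (n : ℕ) (s : B.Cell n) (j : Fin (n + 1)), bump s j x = bump s j y) : x = y := by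
  obtain ⟨n, s, t, ht, rfl⟩ := exists_point_eq x
  obtain ⟨n', s', t', ht', rfl⟩ := exists_point_eq y
  have h1 : n ≤ n' := le_of_bump_ne_zero (h n s 0 ▸ (bump_point_pos s 0 ht).ne')
  have h2 : n' ≤ n := le_of_bump_ne_zero ((h n' s' 0).symm ▸ (bump_point_pos s' 0 ht').ne')
  obtain rfl := le_antisymm h1 h2
  have h3 := h n s 0 ▸ (bump_point_pos s 0 ht).ne'
  rw [bump_point_same] at h3
  obtain rfl : s' = s := by
    by_contra hne
    simp [hne] at h3
  congr 1
  refine stdSimplex.ext (funext fun j => ?_)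
  rw [← coord_point s' j ht, ← coord_point s' j ht']
  simp only [coord, h]

theorem eq_of_point_eq {n : ℕ} {s s' : B.Cell n} {t t' : stdSimplex ℝ (Fin (n + 1))}
    (ht : ∀ i, 0 < t i) (h : point s t = point s' t') : s' = s ∧ t' = t := by
  have h3 := h ▸ (bump_point_pos s 0 ht).ne'
  rw [bump_point_same] at h3
  obtain rfl : s' = s := by
    by_contra hne
    simp [hne] at h3
  rw [if_pos rfl] at h3
  have ht' : ∀ i, 0 < t' i := fun i => lt_of_le_of_ne (stdSimplex.zero_le _ _)
    (Finset.prod_ne_zero_iff.mp (left_ne_zero_of_mul h3) i (Finset.mem_univ i)).symm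
  refine ⟨rfl, stdSimplex.ext (funext fun j => ?_)⟩
  rw [← coord_point s' j ht, ← coord_point s' j ht', h]

/-- Every representation of a point of an open cell factors through that cell. -/
theorem exists_map_eq_of_point_eq {m n : ℕ} {s : B.Cell n} {s' : B.Cell m}
    {t : stdSimplex ℝ (Fin (n + 1))} {t' : stdSimplex ℝ (Fin (m + 1))}
    (ht : ∀ i, 0 < t i) (h : point s t = point s' t') :
    ∃ φ : Fin (n + 1) ↪o Fin (m + 1), B.pull φ s' = s ∧ stdSimplex.map φ t = t' := by
  obtain ⟨l, φ, t'', ht'', rfl⟩ := exists_map_eq t'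
  rw [← point_pull] at h
  have h1 : n ≤ l := le_of_bump_ne_zero (h ▸ (bump_point_pos s 0 ht).ne')
  have h2 : l ≤ n := le_of_bump_ne_zero (h.symm ▸ (bump_point_pos (B.pull φ s') 0 ht'').ne')
  obtain rfl := le_antisymm h1 h2
  obtain ⟨h3, rfl⟩ := eq_of_point_eq ht h
  exact ⟨φ, h3, rfl⟩

/-- Each representation in the closed cell comes from one of finitely many face embeddings applied
to the interior representation of `x`. -/
theorem finite_point_fiber {n : ℕ} (s : B.Cell n) (x : B.Realization) :
    {t | point s t = x}.Finite := by
  obtain ⟨m, s', t, ht, rfl⟩ := exists_point_eq x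
  refine (Set.finite_range fun φ : Fin (m + 1) ↪o Fin (n + 1) => stdSimplex.map φ t).subset ?_
  intro t' h
  obtain ⟨φ, -, rfl⟩ := exists_map_eq_of_point_eq ht (Eq.symm h)
  exact ⟨φ, rfl⟩

/-- The family of all functions `bump s j`. -/
def bumps (x : B.Realization) : (Σ n : ℕ, B.Cell n × Fin (n + 1)) → ℝ :=
  fun c => bump c.2.1 c.2.2 x

theorem continuous_bumps : Continuous (bumps (B := B)) :=
  continuous_pi fun c => continuous_bump c.2.1 c.2.2

theorem bumps_injective : Function.Injective (bumps (B := B)) :=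
  fun _ _ h => eq_of_bump_eq fun n s j => congrFun h ⟨n, s, j⟩

instance : T2Space B.Realization := T2Space.of_injective_continuous bumps_injective continuous_bumps

theorem finite_sigma_cell {d : ℕ} (hf : ∀ n, Finite (B.Cell n))
    (he : ∀ n, d < n → IsEmpty (B.Cell n)) : Finite (Σ n : ℕ, B.Cell n) := by
  refine Finite.of_injective (β := Σ n : Fin (d + 1), B.Cell n)
    (fun c => ⟨⟨c.1, ?_⟩, c.2⟩) ?_
  · by_contra h
    exact (he c.1 (by omega)).false c.2
  · rintro ⟨n, s⟩ ⟨n', s'⟩ h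
    simp only [Sigma.mk.injEq, Fin.mk.injEq] at h
    obtain ⟨rfl, h⟩ := h
    simpa using h

theorem compactSpace_realization {d : ℕ} (hf : ∀ n, Finite (B.Cell n))
    (he : ∀ n, d < n → IsEmpty (B.Cell n)) : CompactSpace B.Realization := by
  have := finite_sigma_cell hf he
  exact inferInstanceAs (CompactSpace (Quot B.Glue))

theorem secondCountable_realization {d : ℕ} (hf : ∀ n, Finite (B.Cell n))
    (he : ∀ n, d < n → IsEmpty (B.Cell n)) : SecondCountableTopology B.Realization := by
  have := finite_sigma_cell hf he
  have := compactSpace_realization hf he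
  have : Countable (Σ n : ℕ, B.Cell n × Fin (n + 1)) := by
    have (n : ℕ) := hf n
    infer_instance
  exact (continuous_bumps.isClosedEmbedding bumps_injective).isEmbedding.secondCountableTopology

end SemiSimplicialSet

/-! ### Isometric windings are tilings, and so are all elements of the hull -/

namespace FBSComplex

open SemiSimplicialSet

variable {E : Type*} [NormedAddCommGroup E] [InnerProductSpace ℝ E] {d : ℕ}
  {K : FBSComplex.{u} E d}

theorem continuous_position {n : ℕ} (s : K.B.Cell n) : Continuous (K.position s) :=
  continuous_finsetSum _ fun i _ => (stdSimplex_continuous_apply i.succ).smul continuous_const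

/-- The closed cell of `s`, translated by `u`, is a tile of `f`. -/
def IsTile (f : C(E, K.Space)) {n : ℕ} (s : K.B.Cell n) (u : E) : Prop :=
  ∀ t, f (u + K.position s t) = point s t

/-- `E` is covered by the tiles of `f`. -/
def IsTiled (f : C(E, K.Space)) : Prop :=
  ∀ y, ∃ (s : K.B.Cell d) (t : stdSimplex ℝ (Fin (d + 1))), IsTile f s (y - K.position s t)

/-- For fixed `s`, this is the projection of a closed set along a compact simplex, and there are
finitely many `s`. Closedness jointly in the map and the point serves both to fill `E` and to pass
to the hull. -/
theorem isClosed_covered [FiniteDimensional ℝ E] :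
    IsClosed {p : C(E, K.Space) × E | ∃ (s : K.B.Cell d) (t : stdSimplex ℝ (Fin (d + 1))),
      IsTile p.1 s (p.2 - K.position s t)} := by
  have := K.finite_cell d
  rw [Set.ofPred_exists]
  refine isClosed_iUnion_of_finite fun s => ?_
  have hc : IsClosed {q : (C(E, K.Space) × E) × stdSimplex ℝ (Fin (d + 1)) |
      IsTile q.1.1 s (q.1.2 - K.position s q.2)} := by
    simp only [IsTile, Set.ofPred_forall]
    refine isClosed_iInter fun t => isClosed_eq ?_ continuous_const
    have := continuous_position s
    fun_prop
  convert isClosedMap_fst_of_compactSpace _ hc using 1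
  ext p
  simp

/-- By lifting segments of `|s|`, the component of `f⁻¹(|s|)` through `y₀` contains the translated
open cell. -/
theorem IsIsometricWinding.apply_add_position {f : C(E, K.Space)} (hf : K.IsIsometricWinding f)
    {n : ℕ} {s : K.B.Cell n} {t₀ t : stdSimplex ℝ (Fin (n + 1))} (ht₀ : ∀ i, 0 < t₀ i)
    (ht : ∀ i, 0 < t i) {y₀ : E} (h : f y₀ = point s t₀) :
    f (y₀ - K.position s t₀ + K.position s t) = point s t := by
  let c (r : unitInterval) : stdSimplex ℝ (Fin (n + 1)) :=
    ⟨(1 - r : ℝ) • t₀.1 + (r : ℝ) • t.1, convex_stdSimplex _ _ t₀.2 t.2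
      (sub_nonneg.2 r.2.2) r.2.1 (by ring)⟩
  have hc : ∀ r i, 0 < c r i := by
    intro r i
    change 0 < (1 - r : ℝ) * t₀ i + (r : ℝ) * t i
    rcases eq_or_lt_of_le r.2.1 with h0 | h0
    · rw [← h0]
      simpa using ht₀ i
    · have := mul_pos h0 (ht i)
      have := mul_nonneg (sub_nonneg.2 r.2.2) (ht₀ i).le
      linarith
  have hcc : Continuous c := by
    refine Continuous.subtype_mk ?_ _
    fun_prop
  have hc0 : c 0 = t₀ := by
    refine Subtype.ext ?_
    simp [c]
  have hc1 : c 1 = t := by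
    refine Subtype.ext ?_
    simp [c]
  let γ : C(unitInterval, openCell s) :=
    ⟨fun r => ⟨point s (c r), c r, hc r, rfl⟩, ((continuous_point s).comp hcc).subtype_mk _⟩
  have hy₀ : y₀ ∈ f ⁻¹' openCell s := ⟨t₀, ht₀, h.symm⟩
  obtain ⟨Γ, hΓ, hΓ0⟩ := (hf.covering n s).exists_path_lifts γ ⟨y₀, hy₀⟩
    (Subtype.ext (by change point s (c 0) = f y₀; rw [hc0, h]))
  have hpre : IsPreconnected (Set.range fun r => ((Γ r : f ⁻¹' openCell s) : E)) :=
    isPreconnected_range (by fun_prop)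
  have hmem : ((Γ 1 : f ⁻¹' openCell s) : E) ∈ connectedComponentIn (f ⁻¹' openCell s) y₀ := by
    refine hpre.subset_connectedComponentIn ⟨0, by simp [hΓ0]⟩ ?_ ⟨1, rfl⟩
    rintro _ ⟨r, rfl⟩
    exact (Γ r).2
  have hval : f (Γ 1) = point s t := by
    have := congrArg Subtype.val (congrFun hΓ 1)
    rw [← hc1]
    exact this
  -- Both ends of the lifted segment lie in one component, so the same translation vector applies to
  -- them.
  obtain ⟨v, hv⟩ := hf.translation n s y₀ hy₀
  have h1 := hv y₀ (mem_connectedComponentIn hy₀) t₀ ht₀ h.symm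
  have h2 := hv _ hmem t ht hval.symm
  rw [h1, h2, ← hval]
  congr 1
  abel

theorem exists_stdSimplex_pos (n : ℕ) : ∃ t : stdSimplex ℝ (Fin (n + 1)), ∀ i, 0 < t i := by
  refine ⟨⟨fun _ => ((n + 1 : ℕ) : ℝ)⁻¹, fun _ => by positivity, ?_⟩, fun i => ?_⟩
  · rw [Finset.sum_const, Finset.card_univ, Fintype.card_fin, nsmul_eq_mul,
      mul_inv_cancel₀ (by positivity)]
  · change (0 : ℝ) < ((n + 1 : ℕ) : ℝ)⁻¹
    positivity

theorem dense_stdSimplex_pos (n : ℕ) : Dense {t : stdSimplex ℝ (Fin (n + 1)) | ∀ i, 0 < t i} := by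
  obtain ⟨b, hb⟩ := exists_stdSimplex_pos n
  intro t
  let c (r : unitInterval) : stdSimplex ℝ (Fin (n + 1)) :=
    ⟨(1 - r : ℝ) • t.1 + (r : ℝ) • b.1, convex_stdSimplex _ _ t.2 b.2
      (sub_nonneg.2 r.2.2) r.2.1 (by ring)⟩
  have hcc : Continuous c := by
    refine Continuous.subtype_mk ?_ _
    fun_prop
  have hc0 : c 0 = t := by
    refine Subtype.ext ?_
    simp [c]
  rw [← hc0]
  have hd : (0 : unitInterval) ∈ closure {r : unitInterval | 0 < r} := by
    rw [show {r : unitInterval | 0 < r} = Set.Ioi 0 from rfl, closure_Ioi' ⟨1, zero_lt_one⟩]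
    exact Set.self_mem_Ici
  refine map_mem_closure hcc hd fun r (hr : 0 < r) i => ?_
  change 0 < (1 - r : ℝ) * t i + (r : ℝ) * b i
  have := mul_pos (show (0 : ℝ) < r from hr) (hb i)
  have := mul_nonneg (sub_nonneg.2 r.2.2) (stdSimplex.zero_le t i)
  linarith

/-- The identity on the open simplex extends to the closed one by continuity and density. -/
theorem IsIsometricWinding.isTile {f : C(E, K.Space)} (hf : K.IsIsometricWinding f)
    {n : ℕ} {s : K.B.Cell n} {t₀ : stdSimplex ℝ (Fin (n + 1))} (ht₀ : ∀ i, 0 < t₀ i)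
    {y₀ : E} (h : f y₀ = point s t₀) : IsTile f s (y₀ - K.position s t₀) := by
  have hcl : IsClosed {t | f (y₀ - K.position s t₀ + K.position s t) = point s t} := by
    have := continuous_position s
    exact isClosed_eq (by fun_prop) (continuous_point s)
  have huniv := (hcl.closure_subset_iff
    (s := {t : stdSimplex ℝ (Fin (n + 1)) | ∀ i, 0 < t i})).2 fun t ht =>
      hf.apply_add_position ht₀ ht h
  rw [(dense_stdSimplex_pos n).closure_eq] at huniv
  exact fun t => huniv (Set.mem_univ t)

section Measure

variable [FiniteDimensional ℝ E] [MeasurableSpace E] [BorelSpace E]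

/-- The preimage is covered by translates of the span of `n < d` edge vectors, a proper subspace and
hence null. One translate for each point of a single fibre suffices, and that fibre is countable
because it is discrete in a second countable space. -/
theorem IsIsometricWinding.volume_preimage_openCell {f : C(E, K.Space)}
    (hf : K.IsIsometricWinding f) {n : ℕ} (hn : n < d) (s : K.B.Cell n) :
    volume (f ⁻¹' openCell s) = 0 := by
  obtain ⟨b, hb⟩ := exists_stdSimplex_pos n
  have hdisc := (hf.covering n s ⟨point s b, b, hb, rfl⟩).1
  have hcount : (f ⁻¹' {point s b}).Countable := by
    have h1 : Countable ((openCell s).restrictPreimage f ⁻¹' {⟨point s b, b, hb, rfl⟩}) :=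
      TopologicalSpace.separableSpace_iff_countable.1 inferInstance
    have h2 := (Set.countable_coe_iff.1 h1).image (Subtype.val : f ⁻¹' openCell s → E)
    refine h2.mono fun y hy => ?_
    exact ⟨⟨y, b, hb, Eq.symm hy⟩, Subtype.ext hy, rfl⟩
  set S : Submodule ℝ E := Submodule.span ℝ (Set.range (K.edgeVec s)) with hS
  have hStop : S ≠ ⊤ := by
    intro h
    have h1 : Module.finrank ℝ S ≤ n := by
      exact (finrank_range_le_card (R := ℝ) (K.edgeVec s)).trans_eq (Fintype.card_fin n)
    rw [h, finrank_top, K.finrank_eq] at h1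
    omega
  have hpos : ∀ t, K.position s t ∈ S := fun t =>
    Submodule.sum_mem _ fun i _ => S.smul_mem _ (Submodule.subset_span ⟨i, rfl⟩)
  have hsub : f ⁻¹' openCell s ⊆
      ⋃ y ∈ f ⁻¹' {point s b}, (fun z => (-y) + z) ⁻¹' (S : Set E) := by
    rintro y ⟨t, ht, hty⟩
    refine Set.mem_iUnion₂.2 ⟨y - K.position s t + K.position s b,
      hf.apply_add_position ht hb hty.symm, ?_⟩
    have : -(y - K.position s t + K.position s b) + y = K.position s t - K.position s b := by
      abel
    simp only [Set.mem_preimage, this]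
    exact S.sub_mem (hpos t) (hpos b)
  refine measure_mono_null hsub ((measure_biUnion_null_iff hcount).2 fun y _ => ?_)
  rw [measure_preimage_add]
  exact Measure.addHaar_submodule _ _ hStop

/-- The covered set is closed, and its complement is null because it maps to cells of dimension
below `d`. A null open set is empty. -/
theorem IsIsometricWinding.isTiled {f : C(E, K.Space)} (hf : K.IsIsometricWinding f) :
    IsTiled f := by
  have hcl : IsClosed {y | ∃ (s : K.B.Cell d) (t : stdSimplex ℝ (Fin (d + 1))),
      IsTile f s (y - K.position s t)} :=
    isClosed_covered.preimage (Continuous.prodMk_right f)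
  have hnull : volume {y | ∃ (s : K.B.Cell d) (t : stdSimplex ℝ (Fin (d + 1))),
      IsTile f s (y - K.position s t)}ᶜ = 0 := by
    have h0 : volume (⋃ n : Fin d, ⋃ s : K.B.Cell n, f ⁻¹' openCell s) = 0 := by
      refine measure_iUnion_null fun n => ?_
      have := K.finite_cell n
      exact measure_iUnion_null fun s => hf.volume_preimage_openCell n.2 s
    refine measure_mono_null (fun y hy => ?_) h0
    obtain ⟨n, s, t, ht, hty⟩ := exists_point_eq (f y)
    have hn : n ≤ d := by
      by_contra h
      exact (K.isEmpty_cell n (by omega)).false s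
    rcases hn.eq_or_lt with rfl | hlt
    · exact absurd ⟨s, t, hf.isTile ht hty.symm⟩ hy
    · exact Set.mem_iUnion.2 ⟨⟨n, hlt⟩, Set.mem_iUnion.2 ⟨s, t, ht, hty⟩⟩
  have := hcl.isOpen_compl.eq_empty_of_measure_zero hnull
  rw [Set.compl_empty_iff] at this
  exact fun y => this.ge (Set.mem_univ y)

end Measure

theorem translate_apply (t : E) (f : C(E, K.Space)) (y : E) : translate t f y = f (y - t) := rfl

theorem isTile_translate {f : C(E, K.Space)} {n : ℕ} {s : K.B.Cell n} {t u : E} :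
    IsTile (translate t f) s u ↔ IsTile f s (u - t) := by
  simp only [IsTile, translate_apply, add_sub_right_comm]

theorem IsTiled.translate {f : C(E, K.Space)} (hf : IsTiled f) (t : E) :
    IsTiled (FBSComplex.translate t f) := by
  intro y
  obtain ⟨s, b, h⟩ := hf (y - t)
  exact ⟨s, b, isTile_translate.2 (by rwa [sub_right_comm])⟩

theorem IsTiled.of_mem_hull [FiniteDimensional ℝ E] {f₀ : C(E, K.Space)} (hf₀ : IsTiled f₀)
    (f : Hull f₀) : IsTiled f.1 := by
  have hcl : IsClosed {f : C(E, K.Space) | IsTiled f} := by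
    simp only [IsTiled, Set.ofPred_forall]
    exact isClosed_iInter fun y => isClosed_covered.preimage (Continuous.prodMk_left y)
  refine closure_minimal ?_ hcl f.2
  rintro _ ⟨t, rfl⟩
  exact hf₀.translate t

end FBSComplex

/-! ### Barycentric coordinates in `E`, generic directions and the fibres of a tiling -/

namespace FBSComplex

open SemiSimplicialSet

variable {E : Type*} [NormedAddCommGroup E] [InnerProductSpace ℝ E] {d : ℕ}
  {K : FBSComplex.{u} E d}

variable (K) in
theorem exists_norm_position_le :
    ∃ R : ℝ, 0 ≤ R ∧ ∀ (s : K.B.Cell d) t, ‖K.position s t‖ ≤ R := by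
  have := K.finite_cell d
  have h (s : K.B.Cell d) : ∃ R : ℝ, ∀ t, ‖K.position s t‖ ≤ R := by
    obtain ⟨R, hR⟩ := isCompact_univ.exists_bound_of_continuousOn (continuous_position s).continuousOn
    exact ⟨R, fun t => hR t (Set.mem_univ t)⟩
  choose R hR using h
  obtain ⟨M, hM⟩ := Set.Finite.bddAbove (Set.finite_range R)
  exact ⟨max M 0, le_max_right _ _, fun s t => (hR s t).trans
    ((hM ⟨s, rfl⟩).trans (le_max_left _ _))⟩

section Barycentric

variable [FiniteDimensional ℝ E]

/-- The edge vectors of a top-dimensional cell, as a basis of `E`. -/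
def edgeBasis (s : K.B.Cell d) : Module.Basis (Fin d) ℝ E :=
  basisOfLinearIndependentOfCardEqFinrank' (K.edgeVec s) (K.linearIndependent s)
    (by rw [Fintype.card_fin, K.finrank_eq])

theorem edgeBasis_apply (s : K.B.Cell d) (i : Fin d) : edgeBasis s i = K.edgeVec s i := by
  exact congrFun (coe_basisOfLinearIndependentOfCardEqFinrank' _ _ _) i

/-- The linear part of the `j`-th barycentric coordinate of a top-dimensional cell. -/
def baryDeriv (s : K.B.Cell d) (j : Fin (d + 1)) : E →ₗ[ℝ] ℝ :=
  Fin.cases (motive := fun _ => E →ₗ[ℝ] ℝ) (-∑ i, (edgeBasis s).coord i)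
    (fun i => (edgeBasis s).coord i) j

theorem baryDeriv_zero (s : K.B.Cell d) : baryDeriv s 0 = -∑ i, (edgeBasis s).coord i := rfl

theorem baryDeriv_succ (s : K.B.Cell d) (i : Fin d) :
    baryDeriv s i.succ = (edgeBasis s).coord i := rfl

theorem sum_baryDeriv (s : K.B.Cell d) (z : E) : ∑ j, baryDeriv s j z = 0 := by
  simp [Fin.sum_univ_succ, baryDeriv_zero, baryDeriv_succ]

/-- The `j`-th barycentric coordinate of a top-dimensional cell. -/
def bary (s : K.B.Cell d) (j : Fin (d + 1)) (z : E) : ℝ :=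
  (if j = 0 then 1 else 0) + baryDeriv s j z

theorem bary_add (s : K.B.Cell d) (j : Fin (d + 1)) (z w : E) :
    bary s j (z + w) = bary s j z + baryDeriv s j w := by
  simp [bary, add_assoc]

theorem sum_bary (s : K.B.Cell d) (z : E) : ∑ j, bary s j z = 1 := by
  simp [bary, Finset.sum_add_distrib, sum_baryDeriv]

theorem continuous_bary (s : K.B.Cell d) (j : Fin (d + 1)) : Continuous (bary s j) :=
  continuous_const.add (LinearMap.continuous_of_finiteDimensional _)

theorem coord_position (s : K.B.Cell d) (i : Fin d) (t : stdSimplex ℝ (Fin (d + 1))) :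
    (edgeBasis s).coord i (K.position s t) = t i.succ := by
  simp only [position, ← edgeBasis_apply, map_sum, map_smul, Module.Basis.coord_apply,
    Module.Basis.repr_self, smul_eq_mul]
  rw [Finset.sum_eq_single i]
  · simp
  · intro b _ hb
    simp [hb]
  · simp

theorem bary_position (s : K.B.Cell d) (j : Fin (d + 1)) (t : stdSimplex ℝ (Fin (d + 1))) :
    bary s j (K.position s t) = t j := by
  have h : ∀ i : Fin d, bary s i.succ (K.position s t) = t i.succ := fun i => by
    rw [bary, baryDeriv_succ, coord_position]
    simp
  induction j using Fin.cases with
  | zero =>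
    have h1 := sum_bary s (K.position s t)
    have h2 := stdSimplex.sum_eq_one t
    rw [Fin.sum_univ_succ] at h1 h2
    simp only [h] at h1
    linarith
  | succ i => exact h i

theorem position_injective (s : K.B.Cell d) : Function.Injective (K.position s) := by
  intro t t' h
  refine stdSimplex.ext (funext fun j => ?_)
  rw [← bary_position s j t, h, bary_position]

theorem exists_position_eq (s : K.B.Cell d) {z : E} (hz : ∀ j, 0 ≤ bary s j z) :
    ∃ t, K.position s t = z := by
  refine ⟨⟨fun j => bary s j z, hz, sum_bary s z⟩, ?_⟩
  have : K.position s ⟨fun j => bary s j z, hz, sum_bary s z⟩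
      = ∑ i, (edgeBasis s).repr z i • edgeBasis s i := by
    simp only [position, edgeBasis_apply]
    refine Finset.sum_congr rfl fun i _ => ?_
    congr 1
    change bary s i.succ z = _
    simp [bary, baryDeriv_succ]
  rw [this, Module.Basis.sum_repr]

/-- The open simplex in `E` spanned by the vertices of a top-dimensional cell. -/
def openSimplex (s : K.B.Cell d) : Set E := {z | ∀ j, 0 < bary s j z}

theorem isOpen_openSimplex (s : K.B.Cell d) : IsOpen (openSimplex s) := by
  simp only [openSimplex, Set.ofPred_forall]
  exact isOpen_iInter_of_finite fun j => isOpen_lt continuous_const (continuous_bary s j)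

theorem position_mem_openSimplex {s : K.B.Cell d} {t : stdSimplex ℝ (Fin (d + 1))} :
    K.position s t ∈ openSimplex s ↔ ∀ j, 0 < t j := by
  simp [openSimplex, bary_position]

theorem exists_of_mem_openSimplex {s : K.B.Cell d} {z : E} (hz : z ∈ openSimplex s) :
    ∃ t, K.position s t = z ∧ ∀ j, 0 < t j := by
  obtain ⟨t, rfl⟩ := exists_position_eq s fun j => (hz j).le
  exact ⟨t, rfl, position_mem_openSimplex.1 hz⟩

theorem openSimplex_nonempty (s : K.B.Cell d) : (openSimplex s).Nonempty := by
  obtain ⟨t, ht⟩ := exists_stdSimplex_pos d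
  exact ⟨_, position_mem_openSimplex.2 ht⟩

/-- The value `f z` lies in an open cell, so it determines the cell and the barycentric coordinates,
and with them the translation. -/
theorem IsTile.eq_of_mem {f : C(E, K.Space)} {s s' : K.B.Cell d} {u u' z : E}
    (h : IsTile f s u) (h' : IsTile f s' u') (hz : z - u ∈ openSimplex s)
    (hz' : z - u' ∈ openSimplex s') : s' = s ∧ u' = u := by
  obtain ⟨t, ht, htp⟩ := exists_of_mem_openSimplex hz
  obtain ⟨t', ht', -⟩ := exists_of_mem_openSimplex hz'
  have h1 := h t
  have h2 := h' t'
  rw [ht, add_sub_cancel] at h1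
  rw [ht', add_sub_cancel] at h2
  obtain ⟨rfl, rfl⟩ := eq_of_point_eq htp (h1.symm.trans h2)
  rw [ht] at ht'
  exact ⟨rfl, (sub_right_inj.1 ht').symm⟩

/-- The translation parts of the tiles of `f` of type `s`. -/
def tileSet (f : C(E, K.Space)) (s : K.B.Cell d) : Set E := {u | IsTile f s u}

theorem disjoint_tiles (f : C(E, K.Space)) (s : K.B.Cell d) :
    Pairwise (Function.onFun Disjoint fun u : tileSet f s => (fun z => z - u.1) ⁻¹' openSimplex s) := by
  intro u u' hne
  refine Set.disjoint_left.2 fun z hz hz' => hne ?_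
  exact Subtype.ext (u.2.eq_of_mem u'.2 hz hz').2.symm

theorem isOpen_tile (s : K.B.Cell d) (u : E) : IsOpen ((fun z => z - u) ⁻¹' openSimplex s) :=
  (isOpen_openSimplex s).preimage (by fun_prop)

theorem countable_tileSet (f : C(E, K.Space)) (s : K.B.Cell d) : (tileSet f s).Countable := by
  have := Set.PairwiseDisjoint.countable_of_isOpen (a := Set.univ)
    (s := fun u : tileSet f s => (fun z => z - u.1) ⁻¹' openSimplex s)
    (fun u _ u' _ h => disjoint_tiles f s h) (fun u _ => isOpen_tile s u.1) ?_
  · rw [← Set.countable_coe_iff]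
    exact Set.countable_univ_iff.1 this
  · rintro u -
    obtain ⟨z, hz⟩ := openSimplex_nonempty s
    exact ⟨z + u.1, by simpa using hz⟩

/-- Packing argument: the open tiles are disjoint, have equal positive volume and stay in a ball of
finite volume. -/
theorem finite_tileSet_inter_closedBall [MeasurableSpace E] [BorelSpace E]
    (f : C(E, K.Space)) (s : K.B.Cell d) (M : ℝ) :
    (tileSet f s ∩ Metric.closedBall 0 M).Finite := by
  obtain ⟨R, -, hR⟩ := K.exists_norm_position_le
  let A (u : ↥(tileSet f s ∩ Metric.closedBall 0 M)) : Set E :=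
    (fun z => z - u.1) ⁻¹' openSimplex s
  have hsub : (⋃ u, A u) ⊆ Metric.closedBall 0 (M + R) := by
    refine Set.iUnion_subset fun u z hz => ?_
    obtain ⟨t, ht, -⟩ := exists_of_mem_openSimplex hz
    have h1 := hR s t
    have h2 := mem_closedBall_zero_iff.1 u.2.2
    rw [ht] at h1
    rw [mem_closedBall_zero_iff]
    calc ‖z‖ = ‖u.1 + (z - u.1)‖ := by rw [add_sub_cancel]
      _ ≤ M + R := (norm_add_le _ _).trans (add_le_add h2 h1)
  have hfin := Measure.finite_const_le_meas_of_disjoint_iUnion (volume : Measure E)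
    (ε := volume (openSimplex s))
    ((isOpen_openSimplex s).measure_pos _ (openSimplex_nonempty s))
    (As := A) (fun u => (isOpen_tile s u.1).measurableSet)
    (fun u u' h => disjoint_tiles f s (i := ⟨u.1, u.2.1⟩) (j := ⟨u'.1, u'.2.1⟩)
      fun he => h (Subtype.ext (Subtype.mk.inj he)))
    ((measure_mono hsub).trans_lt (measure_closedBall_lt_top)).ne
  rw [← Set.finite_coe_iff, ← Set.finite_univ_iff]
  refine hfin.subset fun u _ => ?_
  simp only [A, sub_eq_add_neg]
  exact (measure_preimage_add_right _ _ _).ge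

/-- Directions that are not parallel to any wall of a top-dimensional cell. -/
def IsGeneric (K : FBSComplex.{u} E d) (w : E) : Prop :=
  ∀ (s : K.B.Cell d) (j : Fin (d + 1)), d ≠ 0 → baryDeriv s j w ≠ 0

variable (K) in
-- Finitely many nonzero functionals have a common point of non-vanishing. For `d = 0` the only
-- functional is zero, which is why `IsGeneric` exempts that case.
theorem exists_isGeneric : ∃ w, K.IsGeneric w := by
  rcases eq_or_ne d 0 with hd | hd
  · exact ⟨0, fun _ _ h => absurd hd h⟩
  have := K.finite_cell d
  obtain ⟨w, -, hw⟩ := Module.Dual.exists_forall_mem_ne_zero_of_forall_exists (⊤ : Submodule ℝ E)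
    (fun p : K.B.Cell d × Fin (d + 1) => baryDeriv p.1 p.2) (by
      rintro ⟨s, j⟩
      induction j using Fin.cases with
      | zero =>
        refine ⟨edgeBasis s ⟨0, Nat.pos_of_ne_zero hd⟩, trivial, ?_⟩
        simp [baryDeriv_zero, LinearMap.sum_apply, Finsupp.single_apply]
      | succ i =>
        exact ⟨edgeBasis s i, trivial, by simp [baryDeriv_succ]⟩)
  exact ⟨w, fun s j _ => hw (s, j)⟩

theorem IsGeneric.neg {w : E} (hw : K.IsGeneric w) : K.IsGeneric (-w) := fun s j hd => by
  rw [map_neg]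
  exact neg_ne_zero.2 (hw s j hd)

/-- The representations of `x` in top-dimensional closed cells into which `w` points. -/
def directed (w : E) (x : K.Space) : Set (K.B.Cell d × stdSimplex ℝ (Fin (d + 1))) :=
  {p | point p.1 p.2 = x ∧ ∀ j, p.2 j = 0 → 0 < baryDeriv p.1 j w}

theorem finite_directed (w : E) (x : K.Space) : (directed w x).Finite := by
  have := K.finite_cell d
  have : (⋃ s : K.B.Cell d, Prod.mk s '' {t | point s t = x}).Finite :=
    Set.finite_iUnion fun s => (finite_point_fiber s x).image _
  refine this.subset ?_
  rintro ⟨s, t⟩ ⟨h, -⟩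
  exact Set.mem_iUnion.2 ⟨s, t, h, rfl⟩

theorem eventually_mem_openSimplex {w : E} {x : K.Space}
    {p : K.B.Cell d × stdSimplex ℝ (Fin (d + 1))} (hp : p ∈ directed w x) :
    ∀ᶠ ε : ℝ in 𝓝[>] 0, K.position p.1 p.2 + ε • w ∈ openSimplex p.1 := by
  refine Filter.eventually_all.2 fun j => ?_
  simp only [bary_add, bary_position, map_smul, smul_eq_mul]
  rcases (stdSimplex.zero_le p.2 j).eq_or_lt with h | h
  · filter_upwards [self_mem_nhdsWithin] with ε hε
    rw [← h, zero_add]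
    exact mul_pos hε (hp.2 j h.symm)
  · have hc : Filter.Tendsto (fun ε : ℝ => p.2 j + ε * baryDeriv p.1 j w) (𝓝[>] 0)
        (𝓝 (p.2 j + 0 * baryDeriv p.1 j w)) :=
      Filter.Tendsto.mono_left (Continuous.tendsto (by fun_prop) _) nhdsWithin_le_nhds
    exact hc.eventually_const_lt (by simpa using h)

/-- Push `y` slightly along `w`. Only finitely many tiles come near, so a single tile contains `y +
ε w` for arbitrarily small `ε > 0`. In the limit `y` lies in this closed tile, and a coordinate
vanishing at `y` cannot decrease along `w`. Genericity makes its derivative strictly positive. -/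
theorem IsTiled.exists_tile [MeasurableSpace E] [BorelSpace E]
    {f : C(E, K.Space)} (hf : IsTiled f) {w : E} (hw : K.IsGeneric w)
    (y : E) : ∃ p ∈ directed w (f y), y - K.position p.1 p.2 ∈ tileSet f p.1 := by
  have := K.finite_cell d
  obtain ⟨R, -, hR⟩ := K.exists_norm_position_le
  have hfin : (⋃ s : K.B.Cell d, Prod.mk s ''
      (tileSet f s ∩ Metric.closedBall 0 (‖y‖ + ‖w‖ + R))).Finite :=
    Set.finite_iUnion fun s => (finite_tileSet_inter_closedBall f s _).image _
  have hex : ∃ p ∈ ⋃ s : K.B.Cell d, Prod.mk s ''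
      (tileSet f s ∩ Metric.closedBall 0 (‖y‖ + ‖w‖ + R)),
      ∃ᶠ ε : ℝ in 𝓝[>] 0, ∃ t, y + ε • w = p.2 + K.position p.1 t := by
    by_contra! hcon
    have hev := (Filter.eventually_all_finite hfin).2 hcon
    have hlt : ∀ᶠ ε : ℝ in 𝓝[>] 0, ε < 1 :=
      nhdsWithin_le_nhds (Iio_mem_nhds one_pos)
    obtain ⟨ε, hε, hε1, hε0⟩ := (hev.and (hlt.and self_mem_nhdsWithin)).exists
    obtain ⟨s, t, h⟩ := hf (y + ε • w)
    refine hε (s, y + ε • w - K.position s t) (Set.mem_iUnion.2 ⟨s, _, ⟨h, ?_⟩, rfl⟩)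
      t (sub_add_cancel _ _).symm
    rw [mem_closedBall_zero_iff]
    refine (norm_sub_le _ _).trans (add_le_add ((norm_add_le _ _).trans ?_) (hR s t))
    rw [norm_smul, Real.norm_of_nonneg (le_of_lt hε0)]
    gcongr
    exact mul_le_of_le_one_left (norm_nonneg w) hε1.le
  obtain ⟨⟨s, u⟩, hp, hfreq⟩ := hex
  obtain ⟨s', u', ⟨hu, -⟩, hsu⟩ := Set.mem_iUnion.1 hp
  obtain ⟨rfl, rfl⟩ := Prod.mk.inj hsu
  have hfreq' (j) : ∃ᶠ ε : ℝ in 𝓝[>] 0, 0 ≤ bary s' j (y - u') + ε * baryDeriv s' j w := by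
    refine hfreq.mono ?_
    rintro ε ⟨t, ht⟩
    rw [← smul_eq_mul, ← map_smul, ← bary_add, sub_add_eq_add_sub, ht, add_sub_cancel_left,
      bary_position]
    exact stdSimplex.zero_le t j
  have hnn (j) : 0 ≤ bary s' j (y - u') := by
    by_contra! hlt
    refine hfreq' j ?_
    have hc : Filter.Tendsto (fun ε : ℝ => bary s' j (y - u') + ε * baryDeriv s' j w) (𝓝[>] 0)
        (𝓝 (bary s' j (y - u') + 0 * baryDeriv s' j w)) :=
      Filter.Tendsto.mono_left (Continuous.tendsto (by fun_prop) _) nhdsWithin_le_nhds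
    filter_upwards [hc.eventually_lt_const (u := 0) (by simpa using hlt)] with ε hε
    exact not_le.2 hε
  obtain ⟨t, ht⟩ := exists_position_eq s' hnn
  refine ⟨(s', t), ⟨?_, fun j hj => ?_⟩, ?_⟩
  · have := hu t
    rw [ht, add_sub_cancel] at this
    exact this.symm
  · obtain ⟨ε, hε, hε0⟩ := ((hfreq' j).and_eventually self_mem_nhdsWithin).exists
    rw [← ht, bary_position] at hε
    dsimp only at hj
    rw [hj, zero_add] at hε
    refine lt_of_le_of_ne (nonneg_of_mul_nonneg_right hε hε0) (Ne.symm (hw s' j ?_))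
    -- In dimension zero the only barycentric coordinate equals `1` and cannot vanish.
    rintro rfl
    have := stdSimplex.sum_eq_one t
    rw [Fin.sum_univ_one, show (0 : Fin 1) = j from (Fin.eq_zero j).symm, hj] at this
    exact zero_ne_one this
  · dsimp only
    rwa [ht, sub_sub_cancel]

theorem IsTiled.preimage_singleton [MeasurableSpace E] [BorelSpace E]
    {f : C(E, K.Space)} (hf : IsTiled f) {w : E}
    (hw : K.IsGeneric w) (x : K.Space) :
    f ⁻¹' {x} = ⋃ p ∈ (finite_directed w x).toFinset,
      (fun y => y - K.position p.1 p.2) ⁻¹' tileSet f p.1 := by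
  ext y
  simp only [Set.mem_preimage, Set.mem_singleton_iff, Set.mem_iUnion, Set.Finite.mem_toFinset,
    exists_prop]
  constructor
  · rintro rfl
    exact hf.exists_tile hw y
  · rintro ⟨p, hp, hy⟩
    have := hy p.2
    rw [sub_add_cancel] at this
    rw [this, hp.1]

/-- For small `ε > 0` the point `y + ε w` is in the interior of both tiles, which must then
coincide. -/
theorem disjoint_directed (f : C(E, K.Space)) (w : E) (x : K.Space) :
    ((finite_directed w x).toFinset : Set (K.B.Cell d × stdSimplex ℝ (Fin (d + 1)))).Pairwise
      (Function.onFun Disjoint fun p => (fun y => y - K.position p.1 p.2) ⁻¹' tileSet f p.1) := by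
  intro p hp p' hp' hne
  rw [Set.Finite.coe_toFinset] at hp hp'
  refine Set.disjoint_left.2 fun y hy hy' => hne ?_
  obtain ⟨ε, h, h'⟩ := ((eventually_mem_openSimplex hp).and
    (eventually_mem_openSimplex hp')).exists
  have he (v : E) : y + ε • w - (y - v) = v + ε • w := by abel
  obtain ⟨h1, h2⟩ := IsTile.eq_of_mem (z := y + ε • w) hy hy' (Set.mem_of_eq_of_mem (he _) h)
    (Set.mem_of_eq_of_mem (he _) h')
  obtain ⟨s, t⟩ := p
  obtain ⟨s', t'⟩ := p'
  dsimp only at h1 h2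
  subst h1
  rw [position_injective _ (sub_right_inj.1 h2)]

end Barycentric

end FBSComplex

/-! ### Sums over tiles as integrals, and their pairing with an eigenfunction -/

theorem MeasureTheory.MeasurePreserving.integral_comp_of_aestronglyMeasurable {α : Type*}
    [MeasurableSpace α] {μ : Measure α} {T : α → α} (hT : MeasurePreserving T μ μ) {G : α → ℂ}
    (hG : AEStronglyMeasurable G μ) : ∫ a, G (T a) ∂μ = ∫ a, G a ∂μ := by
  have h := integral_map hT.measurable.aemeasurable (f := G) (by rwa [hT.map_eq])
  rw [hT.map_eq] at h
  exact h.symm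

namespace FBSComplex

open SemiSimplicialSet

variable {E : Type*} [NormedAddCommGroup E] [InnerProductSpace ℝ E] {d : ℕ}
  {K : FBSComplex.{u} E d}

/-- Continuous functions that decay like `‖z‖ ^ (-(n + 1))`. -/
def IsDecaying (n : ℕ) (h : E → ℂ) : Prop :=
  Continuous h ∧ ∃ C : ℝ, ∀ z, ‖h z‖ ≤ C * ((1 + ‖z‖) ^ (n + 1))⁻¹

/-- Moving the argument by at most `R` changes `1 + ‖·‖` by a factor of at most `1 + R`. Decay is
thus stable under the bounded displacements inside a tile. -/
theorem weight_le {n : ℕ} {R : ℝ} {y z : E} (h : ‖y - z‖ ≤ R) :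
    ((1 + ‖z‖) ^ (n + 1))⁻¹ ≤ (1 + R) ^ (n + 1) * ((1 + ‖y‖) ^ (n + 1))⁻¹ := by
  have hz := norm_nonneg z
  have hy := norm_nonneg y
  have hR : 0 ≤ R := (norm_nonneg _).trans h
  have h1 : ‖y‖ ≤ R + ‖z‖ := by
    calc ‖y‖ = ‖(y - z) + z‖ := by rw [sub_add_cancel]
      _ ≤ R + ‖z‖ := (norm_add_le _ _).trans (by gcongr)
  have h2 : 1 + ‖y‖ ≤ (1 + R) * (1 + ‖z‖) := by nlinarith
  rw [← div_eq_mul_inv, le_div_iff₀ (by positivity), inv_mul_le_iff₀ (by positivity), ← mul_pow,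
    mul_comm (1 + ‖z‖)]
  gcongr

theorem IsDecaying.comp_add {n : ℕ} {h : E → ℂ} (hh : IsDecaying n h) (v : E) :
    IsDecaying n fun z => h (z + v) := by
  obtain ⟨hc, C, hC⟩ := hh
  refine ⟨by fun_prop, C * (1 + ‖v‖) ^ (n + 1), fun z => (hC _).trans ?_⟩
  have hC0 : 0 ≤ C := by
    by_contra! hneg
    have h0 := (norm_nonneg _).trans (hC 0)
    simp at h0
    linarith
  rw [mul_assoc]
  exact mul_le_mul_of_nonneg_left (weight_le (by simp)) hC0

theorem isDecaying_schwartz (n : ℕ) (φ : 𝓢(E, ℂ)) : IsDecaying n φ := by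
  refine ⟨φ.continuous, 2 ^ (n + 1) * ((Finset.Iic (n + 1, 0)).sup
    fun m => SchwartzMap.seminorm ℝ m.1 m.2) φ, fun z => ?_⟩
  have h := SchwartzMap.one_add_le_sup_seminorm_apply (𝕜 := ℝ) (m := (n + 1, 0)) le_rfl le_rfl φ z
  rw [norm_iteratedFDeriv_zero] at h
  rw [← div_eq_mul_inv, le_div_iff₀ (by positivity), mul_comm]
  exact h

/-- The point of `E` at which `x ∈ |s|` is located, namely `α_s(x)`. -/
def locate (s : K.B.Cell d) (x : K.Space) : E := ∑ i : Fin d, coord s i.succ x • K.edgeVec s i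

theorem locate_point (s : K.B.Cell d) {t : stdSimplex ℝ (Fin (d + 1))} (ht : ∀ i, 0 < t i) :
    locate s (point s t) = K.position s t := by
  simp only [locate, coord_point s _ ht, position]

theorem exists_point_of_bump_ne_zero {s : K.B.Cell d} {j : Fin (d + 1)} {x : K.Space}
    (h : bump s j x ≠ 0) : ∃ t, (∀ i, 0 < t i) ∧ point s t = x := by
  obtain ⟨n, s', t, ht, rfl⟩ := exists_point_eq x
  have h1 : d ≤ n := le_of_bump_ne_zero h
  have h2 : n ≤ d := by
    by_contra hn
    exact (K.isEmpty_cell n (by omega)).false s'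
  obtain rfl := le_antisymm h1 h2
  rw [bump_point_same] at h
  obtain rfl : s' = s := by
    by_contra hne
    simp [hne] at h
  exact ⟨t, ht, rfl⟩

open Classical in
/-- `h(α_s(x) - y)` for `x ∈ |s|`, extended by zero. -/
def kern (s : K.B.Cell d) (h : E → ℂ) (x : K.Space) (y : E) : ℂ :=
  if bump s 0 x = 0 then 0 else h (locate s x - y)

theorem kern_point (s : K.B.Cell d) (h : E → ℂ) {t : stdSimplex ℝ (Fin (d + 1))}
    (ht : ∀ i, 0 < t i) (y : E) : kern s h (point s t) y = h (K.position s t - y) := by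
  rw [kern, if_neg (bump_point_pos s 0 ht).ne', locate_point s ht]

theorem IsDecaying.exists_norm_kern_le {h : E → ℂ} (hh : IsDecaying d h) (s : K.B.Cell d) :
    ∃ C : ℝ, ∀ x y, ‖kern s h x y‖ ≤ C * ((1 + ‖y‖) ^ (d + 1))⁻¹ := by
  obtain ⟨R, hR0, hR⟩ := K.exists_norm_position_le
  obtain ⟨hc, C, hC⟩ := hh
  have hC0 : 0 ≤ C := by
    by_contra! hneg
    have h0 := (norm_nonneg _).trans (hC 0)
    simp at h0
    linarith
  refine ⟨C * (1 + R) ^ (d + 1), fun x y => ?_⟩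
  by_cases hx : bump s 0 x = 0
  · rw [kern, if_pos hx, norm_zero]
    positivity
  · obtain ⟨t, ht, rfl⟩ := exists_point_of_bump_ne_zero hx
    rw [kern_point s h ht]
    refine (hC _).trans ?_
    rw [mul_assoc]
    refine mul_le_mul_of_nonneg_left ?_ hC0
    rw [← norm_neg y]
    exact weight_le (by rw [norm_sub_rev]; simpa using hR s t)

variable [FiniteDimensional ℝ E]

instance secondCountable_hull (f₀ : C(E, K.Space)) : SecondCountableTopology (Hull f₀) := by
  have := secondCountable_realization K.finite_cell K.isEmpty_cell
  exact inferInstanceAs (SecondCountableTopology ↥(closure (Set.range fun t : E => translate t f₀)))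

theorem continuous_hull_eval (f₀ : C(E, K.Space)) :
    Continuous fun q : Hull f₀ × E => q.1.1 q.2 := by
  have h : Continuous fun f : Hull f₀ => f.1 := continuous_subtype_val
  fun_prop

variable [MeasurableSpace E] [BorelSpace E]

theorem integrable_weight (K : FBSComplex.{u} E d) : Integrable fun y : E => ((1 + ‖y‖) ^ (d + 1))⁻¹ := by
  have h := integrable_one_add_norm (E := E) (μ := volume) (r := ((d + 1 : ℕ) : ℝ)) (by
    rw [K.finrank_eq]
    push_cast
    linarith)
  refine h.congr (Filter.Eventually.of_forall fun y => ?_)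
  dsimp only
  rw [Real.rpow_neg (by positivity), Real.rpow_natCast]

theorem measurable_locate_eval {f₀ : C(E, K.Space)} (s : K.B.Cell d) {α : Type*}
    [MeasurableSpace α] {e : α → Hull f₀ × E} (he : Measurable e) :
    Measurable fun q => locate s ((e q).1.1 (e q).2) := by
  have hb (j) : Measurable fun q => bump s j ((e q).1.1 (e q).2) :=
    ((continuous_bump s j).comp (continuous_hull_eval f₀)).measurable.comp he
  refine Finset.measurable_sum _ fun i _ => Measurable.smul_const ?_ _
  exact (hb _).div (Finset.measurable_sum _ fun i _ => hb i)

open Classical in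
theorem measurable_ite_bump {f₀ : C(E, K.Space)} (s : K.B.Cell d) {α : Type*}
    [MeasurableSpace α] {e : α → Hull f₀ × E} (he : Measurable e) {F : α → ℂ} (hF : Measurable F) :
    Measurable fun q => if bump s 0 ((e q).1.1 (e q).2) = 0 then 0 else F q := by
  have hb : Measurable fun q => bump s 0 ((e q).1.1 (e q).2) :=
    ((continuous_bump s 0).comp (continuous_hull_eval f₀)).measurable.comp he
  exact Measurable.ite (hb (measurableSet_singleton 0)) measurable_const hF

theorem measurable_kern {f₀ : C(E, K.Space)} (s : K.B.Cell d) {h : E → ℂ} (hh : Continuous h)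
    {α : Type*} [MeasurableSpace α] {e : α → Hull f₀ × E} (he : Measurable e) {y : α → E}
    (hy : Measurable y) :
    Measurable fun q => kern s h ((e q).1.1 (e q).2) (y q) :=
  measurable_ite_bump s he (hh.measurable.comp ((measurable_locate_eval s he).sub hy))

/-- The volume of the open simplex of a top-dimensional cell. -/
def vol (s : K.B.Cell d) : ℝ := volume.real (openSimplex s)

theorem vol_pos (s : K.B.Cell d) : 0 < vol s := by
  obtain ⟨R, -, hR⟩ := K.exists_norm_position_le
  refine ENNReal.toReal_pos ((isOpen_openSimplex s).measure_pos _ (openSimplex_nonempty s)).ne' ?_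
  refine ((measure_mono (t := Metric.closedBall 0 R) fun z hz => ?_).trans_lt
    measure_closedBall_lt_top).ne
  obtain ⟨t, rfl, -⟩ := exists_of_mem_openSimplex hz
  simpa using hR s t

/-- The sum of `h(-u)` over all tiles `u` of type `s`, as an integral over `E`. -/
def smear (s : K.B.Cell d) (h : E → ℂ) (f : C(E, K.Space)) : ℂ :=
  (vol s : ℂ)⁻¹ * ∫ y, kern s h (f y) y

theorem IsTiled.support_kern {f : C(E, K.Space)} (hf : IsTiled f) (s : K.B.Cell d) :
    {y | bump s 0 (f y) ≠ 0} = ⋃ u : tileSet f s, (fun z => z - u.1) ⁻¹' openSimplex s := by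
  ext y
  simp only [Set.mem_ofPred_eq, Set.mem_iUnion, Set.mem_preimage]
  constructor
  · intro h
    obtain ⟨t, ht, hty⟩ := exists_point_of_bump_ne_zero h
    obtain ⟨s', t', h'⟩ := hf y
    have h1 := h' t'
    rw [sub_add_cancel, ← hty] at h1
    obtain ⟨rfl, rfl⟩ := eq_of_point_eq ht h1
    exact ⟨⟨_, h'⟩, by simpa using position_mem_openSimplex.2 ht⟩
  · rintro ⟨u, hu⟩
    obtain ⟨t, ht, htp⟩ := exists_of_mem_openSimplex hu
    have h1 := u.2 t
    rw [ht, add_sub_cancel] at h1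
    rw [h1]
    exact (bump_point_pos s 0 htp).ne'

theorem IsDecaying.integrable_kern {f₀ : C(E, K.Space)} {h : E → ℂ} (hh : IsDecaying d h)
    (s : K.B.Cell d) (f : Hull f₀) : Integrable fun y => kern s h (f.1 y) y := by
  obtain ⟨C, hC⟩ := hh.exists_norm_kern_le s
  exact Integrable.mono' (K.integrable_weight.const_mul C)
    (measurable_kern s hh.1 (e := fun y => (f, y)) (by fun_prop) measurable_id).aestronglyMeasurable
    (Filter.Eventually.of_forall fun y => hC _ y)

/-- On the open tile at `u` one has `locate s (f y) - y = -u`, so the kernel is constant there with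
value `h(-u)`. Off the open tiles of type `s` it vanishes. Each tile contributes `vol s * h(-u)`. -/
theorem IsTiled.hasSum_smear {f₀ : C(E, K.Space)} {f : Hull f₀} (hf : IsTiled f.1)
    (s : K.B.Cell d) {h : E → ℂ} (hh : IsDecaying d h) :
    HasSum (fun u : tileSet f.1 s => h (-u.1)) (smear s h f.1) := by
  have : Countable (tileSet f.1 s) := (countable_tileSet f.1 s).to_subtype
  have hs := hasSum_integral_iUnion (μ := volume) (f := fun y => kern s h (f.1 y) y)
    (fun u : tileSet f.1 s => (isOpen_tile s u.1).measurableSet) (disjoint_tiles f.1 s)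
    (hh.integrable_kern s f).integrableOn
  rw [← hf.support_kern s, setIntegral_eq_integral_of_forall_compl_eq_zero] at hs
  · have hval : ∀ u : tileSet f.1 s, ∫ y in (fun z => z - u.1) ⁻¹' openSimplex s,
        kern s h (f.1 y) y = vol s * h (-u.1) := by
      intro u
      rw [setIntegral_congr_fun (g := fun _ => h (-u.1)) (isOpen_tile s u.1).measurableSet,
        setIntegral_const, vol, Complex.real_smul]
      · congr 2
        simp only [measureReal_def, sub_eq_add_neg]
        rw [measure_preimage_add_right]
      · intro y hy
        obtain ⟨t, ht, htp⟩ := exists_of_mem_openSimplex hy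
        have h1 := u.2 t
        rw [ht, add_sub_cancel] at h1
        dsimp only
        rw [h1, kern_point s h htp, ht, sub_sub_cancel_left]
    simp only [hval] at hs
    have hv : (vol s : ℂ) ≠ 0 := by exact_mod_cast (vol_pos s).ne'
    have := hs.mul_left (vol s : ℂ)⁻¹
    simp only [inv_mul_cancel_left₀ hv] at this
    exact this
  · intro y hy
    simp only [Set.mem_ofPred_eq, not_not] at hy
    rw [kern, if_pos hy]

theorem measurable_smear {f₀ : C(E, K.Space)} (s : K.B.Cell d) {h : E → ℂ} (hh : Continuous h) :
    Measurable fun f : Hull f₀ => smear s h f.1 := by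
  refine Measurable.const_mul ?_ _
  have := (measurable_kern (f₀ := f₀) s hh (e := id) measurable_id
    measurable_snd).stronglyMeasurable
  exact (StronglyMeasurable.integral_prod_right (ν := (volume : Measure E)) this).measurable

theorem IsDecaying.exists_norm_smear_le {h : E → ℂ} (hh : IsDecaying d h) (s : K.B.Cell d) :
    ∃ C : ℝ, ∀ f, ‖smear s h f‖ ≤ C := by
  obtain ⟨C, hC⟩ := hh.exists_norm_kern_le s
  refine ⟨‖(vol s : ℂ)⁻¹‖ * ∫ y : E, C * ((1 + ‖y‖) ^ (d + 1))⁻¹, fun f => ?_⟩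
  rw [smear, norm_mul]
  gcongr
  exact norm_integral_le_of_norm_le (K.integrable_weight.const_mul C)
    (Filter.Eventually.of_forall fun y => hC _ y)

theorem IsDecaying.memLp_smear {f₀ : C(E, K.Space)} {h : E → ℂ} (hh : IsDecaying d h)
    (s : K.B.Cell d) (μ : Measure (Hull f₀)) [IsFiniteMeasure μ] :
    MemLp (fun f : Hull f₀ => smear s h f.1) 2 μ := by
  obtain ⟨C, hC⟩ := hh.exists_norm_smear_le s
  exact MemLp.of_bound (measurable_smear s hh.1).aestronglyMeasurable C
    (Filter.Eventually.of_forall fun f => hC f.1)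

/-- A tile at `u` whose representation of `x` is `(s, t)` contains the point `y = u + α_s(t)` of the
fibre, and `φ(-y)` is the translate of `φ` by `-α_s(t)`, evaluated at `-u`. -/
theorem IsTiled.hasSum_gam {f₀ : C(E, K.Space)} {f : Hull f₀} (hf : IsTiled f.1) {w : E}
    (hw : K.IsGeneric w) (x : K.Space) (φ : 𝓢(E, ℂ)) :
    HasSum (fun y : f.1 ⁻¹' {x} => φ (-(y : E)))
      (∑ p ∈ (finite_directed w x).toFinset,
        smear p.1 (fun z => φ (z + -K.position p.1 p.2)) f.1) := by
  rw [hf.preimage_singleton hw x]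
  refine hasSum_sum_disjoint (f := fun y => φ (-y)) _ (disjoint_directed f.1 w x) fun p _ => ?_
  have h := hf.hasSum_smear p.1 ((isDecaying_schwartz d φ).comp_add (-K.position p.1 p.2))
  let e : ((fun y => y - K.position p.1 p.2) ⁻¹' tileSet f.1 p.1) ≃ tileSet f.1 p.1 :=
    { toFun := fun y => ⟨y.1 - K.position p.1 p.2, y.2⟩
      invFun := fun u => ⟨u.1 + K.position p.1 p.2, by simp⟩
      left_inv := fun y => by simp
      right_inv := fun u => by simp }
  rw [← e.hasSum_iff] at h
  convert h using 1
  ext y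
  simp only [Function.comp_apply, e, Equiv.coe_fn_mk]
  congr 1
  abel

section Eigenfunction

variable {f₀ : C(E, K.Space)} {μ : Measure (Hull f₀)} [IsProbabilityMeasure μ]
  {k : E →L[ℝ] ℝ} {ψ : Lp ℂ 2 μ}

open Classical in
/-- The amplitude of the tiles of type `s`. -/
def amplitude (k : E →L[ℝ] ℝ) (ψ : Lp ℂ 2 μ) (s : K.B.Cell d) : ℂ :=
  (vol s : ℂ)⁻¹ * ∫ g, star (ψ g) * (if bump s 0 (g.1 0) = 0 then 0 else
    Complex.exp (2 * Real.pi * Complex.I * (k (locate s (g.1 0)) : ℂ))) ∂μ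

theorem norm_exp_two_pi (a : ℝ) : ‖Complex.exp (2 * Real.pi * Complex.I * (a : ℂ))‖ = 1 := by
  rw [show 2 * Real.pi * Complex.I * (a : ℂ) = ((2 * Real.pi * a : ℝ) : ℂ) * Complex.I by
    push_cast; ring, Complex.norm_exp_ofReal_mul_I]

theorem integral_exp_mul_comp_sub (k : E →L[ℝ] ℝ) (h : E → ℂ) (v : E) :
    ∫ y, Complex.exp (2 * Real.pi * Complex.I * (k y : ℂ)) * h (v - y) =
      Complex.exp (2 * Real.pi * Complex.I * (k v : ℂ)) *
        ∫ y, Complex.exp (-2 * Real.pi * Complex.I * (k y : ℂ)) * h y := by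
  rw [← integral_const_mul]
  rw [← integral_sub_left_eq_self _ volume v]
  refine integral_congr_ae (Filter.Eventually.of_forall fun y => ?_)
  dsimp only
  rw [sub_sub_cancel, ← mul_assoc, ← Complex.exp_add]
  congr 2
  rw [map_sub]
  push_cast
  ring

/-- Integrate over the hull first. Invariance moves the evaluation from `f(y)` to `f(0)` at the
price of the phase `exp(2πi k(y))`. The integral over `y` is then that of the phase against `h(v -
y)` with `v = locate s (f 0)`, which splits into `exp(2πi k(v))` and the Fourier integral of `h`. -/
theorem integral_star_mul_smear (hμ : ∀ t : E, MeasurePreserving (Hull.shift (f₀ := f₀) t) μ μ)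
    (hψ : IsEigenfunction μ k ψ) (s : K.B.Cell d) {h : E → ℂ} (hh : IsDecaying d h) :
    ∫ f, star (ψ f) * smear s h f.1 ∂μ = amplitude k ψ s *
      ∫ y, Complex.exp (-2 * Real.pi * Complex.I * (k y : ℂ)) * h y := by
  obtain ⟨C, hC⟩ := hh.exists_norm_kern_le s
  have hψi : Integrable ψ μ := (Lp.memLp ψ).integrable (by norm_num)
  have hψs : AEStronglyMeasurable (fun f => star (ψ f)) μ :=
    continuous_star.comp_aestronglyMeasurable hψi.1
  -- Both uses of Fubini share this bound. The factor `ψ` is integrable because it is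
  -- square-integrable for a probability measure.
  have hdom : Integrable (fun q : Hull f₀ × E => ‖ψ q.1‖ * (C * ((1 + ‖q.2‖) ^ (d + 1))⁻¹))
      (μ.prod volume) := hψi.norm.mul_prod (K.integrable_weight.const_mul C)
  have hint1 : Integrable (Function.uncurry fun (f : Hull f₀) (y : E) =>
      star (ψ f) * kern s h (f.1 y) y) (μ.prod volume) := by
    refine hdom.mono' (hψs.comp_fst.mul (measurable_kern s hh.1 (e := id) measurable_id
      measurable_snd).aestronglyMeasurable) (Filter.Eventually.of_forall fun q => ?_)
    simp only [Function.uncurry, norm_mul, norm_star]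
    gcongr
    exact hC _ _
  have hint2 : Integrable (Function.uncurry fun (f : Hull f₀) (y : E) =>
      Complex.exp (2 * Real.pi * Complex.I * (k y : ℂ)) * (star (ψ f) * kern s h (f.1 0) y))
      (μ.prod volume) := by
    refine hdom.mono' (AEStronglyMeasurable.mul (Continuous.aestronglyMeasurable (by fun_prop))
      (hψs.comp_fst.mul (measurable_kern s hh.1 (e := fun q : Hull f₀ × E => (q.1, 0))
        (by fun_prop) measurable_snd).aestronglyMeasurable))
      (Filter.Eventually.of_forall fun q => ?_)
    simp only [Function.uncurry, norm_mul, norm_star, norm_exp_two_pi, one_mul]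
    gcongr
    exact hC _ _
  -- Apply the shift by `-y`: it sends `f(0)` to `f(y)`, and the conjugated eigenvalue cancels the
  -- phase.
  have hinv (y : E) : ∫ f, star (ψ f) * kern s h (f.1 y) y ∂μ =
      ∫ f, Complex.exp (2 * Real.pi * Complex.I * (k y : ℂ)) *
        (star (ψ f) * kern s h (f.1 0) y) ∂μ := by
    have hG : AEStronglyMeasurable (fun f : Hull f₀ =>
        Complex.exp (2 * Real.pi * Complex.I * (k y : ℂ)) *
        (star (ψ f) * kern s h (f.1 0) y)) μ :=
      (hψs.mul (measurable_kern s hh.1 (e := fun f : Hull f₀ => (f, 0))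
        (by fun_prop) measurable_const).aestronglyMeasurable).const_mul _
    rw [← (hμ (-y)).integral_comp_of_aestronglyMeasurable hG]
    refine integral_congr_ae ?_
    filter_upwards [hψ.2 y] with f hf
    have hval : (Hull.shift (-y) f).1 0 = f.1 y := by
      change f.1 (0 - -y) = f.1 y
      rw [zero_sub, neg_neg]
    rw [hf, hval, star_mul', ← mul_assoc, ← mul_assoc]
    have hone : Complex.exp (2 * Real.pi * Complex.I * (k y : ℂ)) *
        star (Complex.exp (2 * Real.pi * Complex.I * (k y : ℂ))) = 1 := by
      rw [Complex.star_def, Complex.mul_conj, Complex.normSq_eq_norm_sq, norm_exp_two_pi]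
      simp
    rw [hone, one_mul]
  have h1 : ∫ f, star (ψ f) * smear s h f.1 ∂μ =
      (vol s : ℂ)⁻¹ * ∫ f, (∫ y, star (ψ f) * kern s h (f.1 y) y) ∂μ := by
    rw [← integral_const_mul]
    refine integral_congr_ae (Filter.Eventually.of_forall fun f => ?_)
    dsimp only
    rw [integral_const_mul, smear]
    ring
  rw [h1, integral_integral_swap hint1]
  simp only [hinv]
  rw [← integral_integral_swap hint2, amplitude, mul_assoc (vol s : ℂ)⁻¹, ← integral_mul_const]
  congr 1
  refine integral_congr_ae (Filter.Eventually.of_forall fun f => ?_)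
  dsimp only
  by_cases hb : bump s 0 (f.1 0) = 0
  · simp [kern, hb]
  · simp only [kern, if_neg hb]
    rw [mul_assoc (star (ψ f)), ← integral_exp_mul_comp_sub, ← integral_const_mul]
    refine integral_congr_ae (Filter.Eventually.of_forall fun y => ?_)
    dsimp only
    ring

end Eigenfunction

end FBSComplex

/-! ### The spectral description: approximating the indicator of `{k}` -/

namespace TemperedMatrixMeasure

variable {E : Type*} [NormedAddCommGroup E] [InnerProductSpace ℝ E] {m : ℕ}

theorem normSq_single (ζ : TemperedMatrixMeasure E m) (p : Fin m) (g : (E →L[ℝ] ℝ) → ℂ) :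
    ζ.normSq (fun κ => Pi.single p (g κ)) =
      ∫⁻ κ, ENNReal.ofReal (‖g κ‖ ^ 2 * (ζ.density κ p p).re) ∂ζ.base := by
  refine lintegral_congr fun κ => ?_
  congr 1
  rw [Matrix.mulVec_single, ← Pi.single_star, single_dotProduct]
  simp only [Pi.smul_apply, Matrix.col_apply, MulOpposite.smul_eq_mul_unop, MulOpposite.unop_op]
  rw [mul_left_comm, mul_comm, Complex.star_def, mul_comm _ (g κ), Complex.mul_conj,
    Complex.normSq_eq_norm_sq, Complex.re_ofReal_mul]

/-- A dominating function for scalar functions bounded by one and supported near `k`. -/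
def localBound (ζ : TemperedMatrixMeasure E m) (k κ : E →L[ℝ] ℝ) : ℝ :=
  (2 + ‖k‖) ^ ζ.tempered.choose *
    (((1 + ‖κ‖) ^ ζ.tempered.choose)⁻¹ * (ζ.density κ).trace.re)

theorem lintegral_localBound_lt_top (ζ : TemperedMatrixMeasure E m) (k : E →L[ℝ] ℝ) :
    ∫⁻ κ, ENNReal.ofReal (ζ.localBound k κ) ∂ζ.base < ∞ :=
  (ζ.tempered.choose_spec.const_mul _).lintegral_lt_top

/-- Positivity bounds a diagonal entry by the trace, and within distance `1` of `k` the tempered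
weight is bounded below because `1 + ‖κ‖ ≤ 2 + ‖k‖`. -/
theorem norm_sq_mul_le_localBound (ζ : TemperedMatrixMeasure E m) {k κ : E →L[ℝ] ℝ} (p : Fin m)
    {a : ℂ} (ha : ‖a‖ ≤ 1) (h0 : 1 < ‖κ - k‖ → a = 0) :
    ‖a‖ ^ 2 * (ζ.density κ p p).re ≤ ζ.localBound k κ := by
  have hdiag (q : Fin m) : 0 ≤ (ζ.density κ q q).re :=
    (Complex.nonneg_iff.1 ((ζ.posSemidef κ).diag_nonneg (i := q))).1
  have htr : (ζ.density κ p p).re ≤ (ζ.density κ).trace.re := by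
    rw [Matrix.trace, Complex.re_sum]
    exact Finset.single_le_sum (f := fun q => (ζ.density κ q q).re) (fun q _ => hdiag q)
      (Finset.mem_univ p)
  have htr0 := (hdiag p).trans htr
  by_cases h : 1 < ‖κ - k‖
  · rw [h0 h, localBound]
    simp only [norm_zero, ne_eq, OfNat.ofNat_ne_zero, not_false_eq_true, zero_pow, zero_mul]
    positivity
  · have hκ : 1 + ‖κ‖ ≤ 2 + ‖k‖ := by
      have : ‖κ‖ ≤ ‖κ - k‖ + ‖k‖ := by simpa using norm_add_le (κ - k) k
      linarith
    have h1 : 1 ≤ (2 + ‖k‖) ^ ζ.tempered.choose * ((1 + ‖κ‖) ^ ζ.tempered.choose)⁻¹ := by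
      rw [← div_eq_mul_inv, one_le_div (by positivity)]
      gcongr
    have h2 : ‖a‖ ^ 2 ≤ 1 := pow_le_one₀ (norm_nonneg a) ha
    rw [localBound, ← mul_assoc]
    exact mul_le_mul (h2.trans h1) htr (hdiag p) (zero_le_one.trans h1)

theorem memL2_single (ζ : TemperedMatrixMeasure E m) (k : E →L[ℝ] ℝ) (p : Fin m)
    {g : (E →L[ℝ] ℝ) → ℂ} (hg : Measurable g) (h1 : ∀ κ, ‖g κ‖ ≤ 1)
    (h0 : ∀ κ, 1 < ‖κ - k‖ → g κ = 0) : ζ.MemL2 fun κ => Pi.single p (g κ) := by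
  refine ⟨?_, ?_⟩
  · refine measurable_pi_iff.2 fun q => ?_
    rcases eq_or_ne q p with rfl | hq
    · simpa using hg
    · simp [Pi.single_eq_of_ne hq]
  · rw [normSq_single]
    refine (lintegral_mono fun κ => ENNReal.ofReal_le_ofReal ?_).trans_lt
      (ζ.lintegral_localBound_lt_top k)
    exact ζ.norm_sq_mul_le_localBound p (h1 κ) (h0 κ)

end TemperedMatrixMeasure

namespace FBSComplex

open SemiSimplicialSet

variable {E : Type*} [NormedAddCommGroup E] [InnerProductSpace ℝ E] {d : ℕ}
  {K : FBSComplex.{u} E d} [FiniteDimensional ℝ E] [MeasurableSpace E] [BorelSpace E]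

/-- Bump functions around `k` on the dual of `E` are Fourier transforms of Schwartz functions. -/
theorem exists_fourierDual_bump (k : E →L[ℝ] ℝ) {r : ℝ} (hr : 0 < r) :
    ∃ φ : 𝓢(E, ℂ), fourierDual φ k = 1 ∧ Measurable (fourierDual φ) ∧
      (∀ κ, ‖fourierDual φ κ‖ ≤ 1) ∧ ∀ κ, r ≤ ‖κ - k‖ → fourierDual φ κ = 0 := by
  let e := (InnerProductSpace.toDual ℝ E).symm
  let b : ContDiffBump (e k) := ⟨r / 2, r, by linarith, by linarith⟩
  have hs : HasCompactSupport fun y : E => ((b y : ℝ) : ℂ) :=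
    b.hasCompactSupport.comp_left (g := fun a : ℝ => (a : ℂ)) Complex.ofReal_zero
  have hd : ContDiff ℝ (⊤ : ℕ∞) fun y : E => ((b y : ℝ) : ℂ) :=
    Complex.ofRealCLM.contDiff.comp b.contDiff
  let g : 𝓢(E, ℂ) := hs.toSchwartzMap hd
  -- The function is the inverse Fourier transform of a smooth bump, with the dual identified with
  -- `E` by the Riesz isomorphism `e`.
  let φ : 𝓢(E, ℂ) := FourierTransformInv.fourierInv g
  have hφ (κ : E →L[ℝ] ℝ) : fourierDual φ κ = (b (e κ) : ℂ) := by
    have h1 : FourierTransform.fourier φ = g := FourierTransform.fourier_fourierInv_eq g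
    have h2 : FourierTransform.fourier φ (e κ) = (b (e κ) : ℂ) := by
      rw [h1]
      rfl
    rw [← h2, SchwartzMap.fourier_coe, Real.fourier_eq', fourierDual]
    refine integral_congr_ae (Filter.Eventually.of_forall fun y => ?_)
    dsimp only
    rw [smul_eq_mul, real_inner_comm, InnerProductSpace.toDual_symm_apply]
    congr 2
    push_cast
    ring
  have hdist (κ : E →L[ℝ] ℝ) : dist (e κ) (e k) = ‖κ - k‖ := by
    rw [e.dist_map, dist_eq_norm]
  refine ⟨φ, ?_, ?_, fun κ => ?_, fun κ hκ => ?_⟩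
  · rw [hφ, b.one_of_mem_closedBall (Metric.mem_closedBall_self b.rIn_pos.le), Complex.ofReal_one]
  · simp only [funext hφ]
    exact (Complex.continuous_ofReal.comp (b.continuous.comp e.continuous)).measurable
  · rw [hφ, Complex.norm_real, Real.norm_of_nonneg b.nonneg]
    exact b.le_one
  · rw [hφ, b.zero_of_le_dist (by rw [hdist]; exact hκ), Complex.ofReal_zero]

variable {f₀ : C(E, K.Space)} {μ : Measure (Hull f₀)} [IsProbabilityMeasure μ]
  {k : E →L[ℝ] ℝ} {ψ : Lp ℂ 2 μ}

open Classical in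
-- Take Schwartz functions whose Fourier transforms are bumps equal to `1` at `k` with radii
-- shrinking to zero. Their pairings with `ψ` all equal `a (x p)`, while the bumps converge to the
-- indicator in `L²(ζ)` by dominated convergence. The isometry carries this convergence to `L²(μ)`.
theorem inner_spectralEmbedding_indicator {a : K.Space → ℂ}
    (ha : ∀ (x : K.Space) (φ : 𝓢(E, ℂ)), ∫ f, star (ψ f) * Gam x φ f ∂μ = a x * fourierDual φ k)
    {m : ℕ} {x : Fin m → K.Space} {ζ : TemperedMatrixMeasure E m}
    {Θ : ((E →L[ℝ] ℝ) → Fin m → ℂ) → Lp ℂ 2 μ} (hΘ : IsSpectralEmbedding μ x ζ Θ) (p : Fin m) :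
    inner ℂ ψ (Θ fun κ => Pi.single p (if κ = k then 1 else 0)) = a (x p) := by
  have hr (n : ℕ) : (0 : ℝ) < ((n : ℝ) + 1)⁻¹ := by positivity
  choose φ hφk hφm hφ1 hφ0 using fun n => exists_fourierDual_bump k (hr n)
  have hr1 (n : ℕ) : ((n : ℝ) + 1)⁻¹ ≤ 1 := inv_le_one_of_one_le₀ (by simp)
  let δ : (E →L[ℝ] ℝ) → ℂ := fun κ => if κ = k then 1 else 0
  let D (n : ℕ) : (E →L[ℝ] ℝ) → ℂ := fun κ => fourierDual (φ n) κ - δ κ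
  have hδm : Measurable δ :=
    Measurable.ite (measurableSet_singleton k) measurable_const measurable_const
  have hDk (n) : D n k = 0 := by simp [D, δ, hφk]
  have hDne (n) {κ} (hκ : κ ≠ k) : D n κ = fourierDual (φ n) κ := by simp [D, δ, hκ]
  have hD1 (n κ) : ‖D n κ‖ ≤ 1 := by
    rcases eq_or_ne κ k with rfl | h
    · simp [hDk]
    · rw [hDne n h]
      exact hφ1 n κ
  have hne {κ : E →L[ℝ] ℝ} (h : 1 < ‖κ - k‖) : κ ≠ k := by
    rintro rfl
    simp at h
    linarith
  have hD0 (n κ) (h : 1 < ‖κ - k‖) : D n κ = 0 := by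
    rw [hDne n (hne h)]
    exact hφ0 n κ ((hr1 n).trans h.le)
  have hDm (n) : Measurable (D n) := (hφm n).sub hδm
  have hDL (n) := ζ.memL2_single k p (hDm n) (hD1 n) (hD0 n)
  have hδL := ζ.memL2_single k p hδm
    (fun κ => by dsimp only [δ]; split_ifs <;> simp) (fun κ h => if_neg (hne h))
  have hsum (n) : Θ (fun κ => Pi.single p (fourierDual (φ n) κ)) =
      Θ (fun κ => Pi.single p (D n κ)) + Θ (fun κ => Pi.single p (δ κ)) := by
    rw [← hΘ.map_add _ _ (hDL n) hδL]
    congr 1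
    ext κ : 1
    simp only [Pi.add_apply, ← Pi.single_add, D, sub_add_cancel]
  have hinner (n) : inner ℂ ψ (Θ fun κ => Pi.single p (fourierDual (φ n) κ)) = a (x p) := by
    have h1 := ha (x p) (φ n)
    rw [hφk, mul_one] at h1
    rw [← h1, L2.inner_def]
    refine integral_congr_ae ?_
    filter_upwards [hΘ.schwartz (φ n) p] with f hf
    rw [hf, RCLike.inner_apply, mul_comm]
    rfl
  have hnormSq : Filter.Tendsto (fun n => ζ.normSq fun κ => Pi.single p (D n κ)) Filter.atTop
      (𝓝 0) := by
    simp only [ζ.normSq_single]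
    have h := tendsto_lintegral_of_dominated_convergence (μ := ζ.base)
      (F := fun n κ => ENNReal.ofReal (‖D n κ‖ ^ 2 * (ζ.density κ p p).re)) (f := fun _ => 0)
      (fun κ => ENNReal.ofReal (ζ.localBound k κ)) (fun n => ?_) (fun n => ?_)
      (ζ.lintegral_localBound_lt_top k).ne ?_
    · simpa using h
    · exact (((hDm n).norm.pow_const 2).mul
        (Complex.measurable_re.comp (ζ.measurable_density p p))).ennreal_ofReal
    · exact Filter.Eventually.of_forall fun κ => ENNReal.ofReal_le_ofReal
        (ζ.norm_sq_mul_le_localBound p (hD1 n κ) (hD0 n κ))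
    -- The difference is zero at `k` itself, and at any other point it vanishes once the radius is
    -- at most the distance to `k`.
    · refine Filter.Eventually.of_forall fun κ => ?_
      refine tendsto_const_nhds.congr' ?_
      rcases eq_or_ne κ k with rfl | h
      · simp [hDk]
      · have hpos : 0 < ‖κ - k‖ := norm_pos_iff.2 (sub_ne_zero.2 h)
        have hlim : Filter.Tendsto (fun n : ℕ => ((n : ℝ) + 1)⁻¹) Filter.atTop (𝓝 0) := by
          simpa using tendsto_one_div_add_atTop_nhds_zero_nat (𝕜 := ℝ)
        filter_upwards [hlim.eventually_lt_const hpos] with n hn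
        rw [hDne n h, hφ0 n κ hn.le]
        simp
  have hnorm : Filter.Tendsto (fun n => ‖Θ fun κ => Pi.single p (D n κ)‖) Filter.atTop
      (𝓝 0) := by
    have h2 : Filter.Tendsto (fun n => ‖Θ fun κ => Pi.single p (D n κ)‖ ^ 2) Filter.atTop
        (𝓝 0) := by
      have h3 := (ENNReal.tendsto_toReal ENNReal.zero_ne_top).comp hnormSq
      refine h3.congr fun n => ?_
      rw [Function.comp_apply, ← hΘ.isometry _ (hDL n), ENNReal.toReal_ofReal (by positivity)]
    have h3 := h2.sqrt
    simpa [Real.sqrt_sq (norm_nonneg _)] using h3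
  have hlim : Filter.Tendsto (fun n => inner ℂ ψ (Θ fun κ => Pi.single p (D n κ))) Filter.atTop
      (𝓝 0) := by
    refine squeeze_zero_norm (fun n => norm_inner_le_norm (𝕜 := ℂ) ψ _) ?_
    simpa using hnorm.const_mul ‖ψ‖
  have hfin : Filter.Tendsto (fun n => inner ℂ ψ (Θ fun κ => Pi.single p (D n κ)) +
      inner ℂ ψ (Θ fun κ => Pi.single p (δ κ))) Filter.atTop (𝓝 (a (x p))) := by
    refine tendsto_const_nhds.congr fun n => ?_
    rw [← hinner n, hsum n, inner_add_right]
  exact tendsto_nhds_unique (by simpa using hlim.add_const _) hfin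

/-- The partial amplitudes in terms of the amplitudes of the tiles on the `w`-side of a point. -/
def partialAmplitude (k : E →L[ℝ] ℝ) (ψ : Lp ℂ 2 μ) (w : E) (x : K.Space) : ℂ :=
  ∑ p ∈ (finite_directed w x).toFinset, amplitude k ψ p.1 *
    Complex.exp (-2 * Real.pi * Complex.I * (k (K.position p.1 p.2) : ℂ))

theorem integral_exp_mul_comp_add (k : E →L[ℝ] ℝ) (φ : E → ℂ) (v : E) :
    ∫ y, Complex.exp (-2 * Real.pi * Complex.I * (k y : ℂ)) * φ (y + -v) =
      Complex.exp (-2 * Real.pi * Complex.I * (k v : ℂ)) *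
        ∫ y, Complex.exp (-2 * Real.pi * Complex.I * (k y : ℂ)) * φ y := by
  rw [← integral_const_mul]
  rw [← integral_add_right_eq_self (μ := volume) _ v]
  refine integral_congr_ae (Filter.Eventually.of_forall fun y => ?_)
  dsimp only
  rw [add_neg_cancel_right, ← mul_assoc, ← Complex.exp_add]
  congr 2
  rw [map_add]
  push_cast
  ring

theorem gam_eq_sum_smear (hf₀ : IsTiled f₀) {w : E} (hw : K.IsGeneric w) (x : K.Space)
    (φ : 𝓢(E, ℂ)) : Gam (f₀ := f₀) x φ = fun f => ∑ p ∈ (finite_directed w x).toFinset,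
        smear p.1 (fun z => φ (z + -K.position p.1 p.2)) f.1 :=
  funext fun f => ((hf₀.of_mem_hull f).hasSum_gam hw x φ).tsum_eq

theorem integral_star_mul_gam (hf₀ : IsTiled f₀)
    (hμ : ∀ t : E, MeasurePreserving (Hull.shift (f₀ := f₀) t) μ μ)
    (hψ : IsEigenfunction μ k ψ) {w : E} (hw : K.IsGeneric w) (x : K.Space) (φ : 𝓢(E, ℂ)) :
    ∫ f, star (ψ f) * Gam x φ f ∂μ = partialAmplitude k ψ w x * fourierDual φ k := by
  have hdec (p : K.B.Cell d × stdSimplex ℝ (Fin (d + 1))) :=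
    (isDecaying_schwartz d φ).comp_add (-K.position p.1 p.2)
  rw [gam_eq_sum_smear hf₀ hw]
  simp only [Finset.mul_sum]
  rw [integral_finsetSum, partialAmplitude, Finset.sum_mul]
  · refine Finset.sum_congr rfl fun p _ => ?_
    rw [integral_star_mul_smear hμ hψ p.1 (hdec p), integral_exp_mul_comp_add, fourierDual]
    ring
  · intro p _
    exact MemLp.integrable_mul (p := 2) (q := 2) (Lp.memLp ψ).star ((hdec p).memLp_smear p.1 μ)

theorem isPartialAmplitude_partialAmplitude (hf₀ : IsTiled f₀)
    (hμ : ∀ t : E, MeasurePreserving (Hull.shift (f₀ := f₀) t) μ μ)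
    (hψ : IsEigenfunction μ k ψ) {w : E} (hw : K.IsGeneric w) :
    IsPartialAmplitude μ k ψ (partialAmplitude k ψ w) where
  summable x φ f := ((hf₀.of_mem_hull f).hasSum_gam hw x φ).summable
  memLp x φ := by
    rw [gam_eq_sum_smear hf₀ hw]
    exact memLp_finsetSum _ fun p _ =>
      ((isDecaying_schwartz d φ).comp_add (-K.position p.1 p.2)).memLp_smear p.1 μ
  integral_eq := integral_star_mul_gam hf₀ hμ hψ hw
  spectral_eq _ _ _ _ _ hΘ p :=
    inner_spectralEmbedding_indicator (integral_star_mul_gam hf₀ hμ hψ hw) hΘ p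

/-- A single test function with `φ̂(k) = 1` reads off the amplitude at every site. -/
theorem IsPartialAmplitude.unique {a a' : K.Space → ℂ} (ha : IsPartialAmplitude μ k ψ a)
    (ha' : IsPartialAmplitude μ k ψ a') : a = a' := by
  obtain ⟨φ, hφ, -⟩ := exists_fourierDual_bump k one_pos
  ext x
  have h := (ha.integral_eq x φ).symm.trans (ha'.integral_eq x φ)
  simpa [hφ] using h

end FBSComplex

/-! ### Faces, changes of reference vertex and orientations -/

namespace FBSComplex

open SemiSimplicialSet

section Faces

variable {E : Type*} [NormedAddCommGroup E] [InnerProductSpace ℝ E] {d : ℕ}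
  {K : FBSComplex.{u} E d}

theorem edgeEmb_zero {n : ℕ} (i : Fin n) : edgeEmb i 0 = 0 := rfl

theorem edgeEmb_one {n : ℕ} (i : Fin n) : edgeEmb i 1 = i.succ := rfl

theorem edgeVec_face_succ {n : ℕ} (s : K.B.Cell (n + 1)) (i : Fin (n + 1)) (l : Fin n) :
    K.edgeVec (K.B.face i.succ s) l = K.edgeVec s (i.succAbove l) := by
  have h : (edgeEmb l).trans (Fin.succAboveOrderEmb i.succ) = edgeEmb (i.succAbove l) := by
    ext a
    fin_cases a <;> simp [edgeEmb_zero, edgeEmb_one]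
  rw [edgeVec, edgeVec, edge, face, pull_pull, h, edge]

/-- The embedding `[2] → [n + 1]` with image `{0, 1, l + 2}`. -/
def triangleEmb {n : ℕ} (l : Fin n) : Fin (2 + 1) ↪o Fin (n + 1 + 1) :=
  OrderEmbedding.ofStrictMono ![0, 1, l.succ.succ] (by
    intro a b h
    fin_cases a <;> fin_cases b <;> simp_all [Fin.lt_def])

theorem triangleEmb_zero {n : ℕ} (l : Fin n) : triangleEmb l 0 = 0 := rfl

theorem triangleEmb_one {n : ℕ} (l : Fin n) : triangleEmb l 1 = 1 := rfl

theorem triangleEmb_two {n : ℕ} (l : Fin n) : triangleEmb l 2 = l.succ.succ := rfl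

/-- Deleting vertex `0` makes vertex `1` the reference vertex. The formula is the vanishing of `ρ`
on the boundary of the triangle with vertices `0`, `1`, `l + 2`. -/
theorem edgeVec_face_zero {n : ℕ} (s : K.B.Cell (n + 1)) (l : Fin n) :
    K.edgeVec (K.B.face 0 s) l = K.edgeVec s l.succ - K.edgeVec s 0 := by
  have h := K.ρ_boundary (K.B.pull (triangleEmb l) s)
  have h0 : (Fin.succAboveOrderEmb 0).trans (triangleEmb l) =
      (edgeEmb l).trans (Fin.succAboveOrderEmb 0) := by
    ext a
    fin_cases a <;> simp [edgeEmb_zero, edgeEmb_one, triangleEmb_one, triangleEmb_two]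
  have h1 : (Fin.succAboveOrderEmb 1).trans (triangleEmb l) = edgeEmb l.succ := by
    ext a
    fin_cases a <;> simp [edgeEmb_zero, edgeEmb_one, triangleEmb_zero,
      triangleEmb_one, triangleEmb_two, Fin.succAbove]
  have h2 : (Fin.succAboveOrderEmb 2).trans (triangleEmb l) = edgeEmb 0 := by
    ext a
    fin_cases a <;> simp [edgeEmb_zero, edgeEmb_one, triangleEmb_zero,
      triangleEmb_one, triangleEmb_two, Fin.succAbove]
  have e0 : K.B.face 0 (K.B.pull (triangleEmb l) s) = K.B.edge l (K.B.face 0 s) := by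
    rw [face, pull_pull, h0, edge, face, pull_pull]
  have e1 : K.B.face 1 (K.B.pull (triangleEmb l) s) = K.B.edge l.succ s := by
    rw [face, pull_pull, h1, edge]
  have e2 : K.B.face 2 (K.B.pull (triangleEmb l) s) = K.B.edge 0 s := by
    rw [face, pull_pull, h2, edge]
  rw [e0, e1, e2, map_add, map_sub] at h
  change K.edgeVec _ l - K.edgeVec s l.succ + K.edgeVec s 0 = 0 at h
  rw [eq_sub_iff_add_eq, ← sub_eq_zero, ← h]
  abel

theorem map_succAbove_self {n : ℕ} (j : Fin (n + 2)) (t : stdSimplex ℝ (Fin (n + 1))) :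
    stdSimplex.map (Fin.succAboveOrderEmb j) t j = 0 :=
  stdSimplex_map_apply_of_notMem_range t (by simp)

theorem map_succAbove_succAbove {n : ℕ} (j : Fin (n + 2)) (t : stdSimplex ℝ (Fin (n + 1)))
    (i : Fin (n + 1)) : stdSimplex.map (Fin.succAboveOrderEmb j) t (j.succAbove i) = t i :=
  stdSimplex_map_apply_of_injective (Fin.succAboveOrderEmb j).injective t i

/-- Only the face opposite vertex `0` changes the reference vertex, which is why the phase of the
face operators is nontrivial only there. -/
theorem position_map_succAbove {n : ℕ} (s : K.B.Cell (n + 1)) (j : Fin (n + 2))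
    (t : stdSimplex ℝ (Fin (n + 1))) :
    K.position s (stdSimplex.map (Fin.succAboveOrderEmb j) t) =
      K.position (K.B.face j s) t + K.faceShift s j := by
  induction j using Fin.cases with
  | zero =>
    have h (l : Fin (n + 1)) : stdSimplex.map (Fin.succAboveOrderEmb (0 : Fin (n + 2))) t l.succ = t l := by
      simpa using map_succAbove_succAbove 0 t l
    have h0 : t 0 = 1 - ∑ l : Fin n, t l.succ := by
      rw [eq_sub_iff_add_eq, ← Fin.sum_univ_succ, stdSimplex.sum_eq_one]
    simp only [position, faceShift, if_true, edgeVec_face_zero, h, Fin.sum_univ_succ, h0, sub_smul,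
      one_smul, smul_sub, Finset.sum_sub_distrib, Finset.sum_smul]
    abel
  | succ i =>
    have h (l : Fin n) : stdSimplex.map (Fin.succAboveOrderEmb i.succ) t (i.succAbove l).succ =
        t l.succ := by
      rw [← Fin.succ_succAbove_succ, map_succAbove_succAbove]
    simp only [position, faceShift, Fin.succ_ne_zero, if_false, edgeVec_face_succ,
      Fin.sum_univ_succAbove _ i, h, map_succAbove_self, zero_smul, zero_add, add_zero]

theorem exists_eq_succAboveOrderEmb {n : ℕ} (φ : Fin (n + 1) ↪o Fin (n + 2)) :
    ∃ j, φ = Fin.succAboveOrderEmb j := by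
  have : ∃ j, j ∉ Set.range φ := by
    by_contra! h
    have := Fintype.card_le_of_surjective φ h
    simp at this
  obtain ⟨j, hj⟩ := this
  choose g hg using fun i => Fin.exists_succAbove_eq (x := φ i) (y := j) fun h => hj ⟨i, h⟩
  have hmono : StrictMono g := fun a b hab => by
    have := φ.strictMono hab
    rw [← hg a, ← hg b] at this
    exact (Fin.strictMono_succAbove j).lt_iff_lt.1 this
  have hid := orderEmbedding_eq_refl (OrderEmbedding.ofStrictMono g hmono)
  refine ⟨j, ?_⟩
  ext i
  have h2 : g i = i := DFunLike.congr_fun hid i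
  rw [← hg i, h2]
  rfl

end Faces

section Orientation

variable {E : Type*} [NormedAddCommGroup E] [InnerProductSpace ℝ E] [FiniteDimensional ℝ E]

/-- Row operations give the case of `v 0`. Replacing `v 0` by another `v i` adds a difference that
is already among the remaining rows. -/
theorem det_cons_sub {n : ℕ} (e : Module.Basis (Fin (n + 1)) ℝ E) (v : Fin (n + 1) → E)
    (i : Fin (n + 1)) :
    e.det (Matrix.vecCons (v i) fun l : Fin n => v l.succ - v 0) = e.det v := by
  have h0 : e.det (Matrix.vecCons (v 0) fun l : Fin n => v l.succ - v 0) = e.det v := by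
    rw [e.det_apply, e.det_apply, ← Matrix.det_transpose, ← Matrix.det_transpose (e.toMatrix v)]
    refine Matrix.det_eq_of_forall_row_eq_smul_add_const (fun i => if i = 0 then 0 else -1) 0
      (by simp) fun i j => ?_
    induction i using Fin.cases with
    | zero => simp [Module.Basis.toMatrix_apply]
    | succ i => simp [Module.Basis.toMatrix_apply, sub_eq_add_neg]
  induction i using Fin.cases with
  | zero => exact h0
  | succ i =>
    have h1 : e.det (Matrix.vecCons (v i.succ - v 0) fun l : Fin n => v l.succ - v 0) = 0 :=
      e.det.map_eq_zero_of_eq _ (i := 0) (j := i.succ) (by simp) (Fin.succ_ne_zero i).symm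
    rw [← sub_add_cancel (v i.succ) (v 0), AlternatingMap.map_vecCons_add, h1, zero_add, h0]

variable {n : ℕ} {K : FBSComplex.{u} E (n + 1)}

/-- Both sides are linear in `w`, so it is enough to compare them on the edge vectors of `s`. The
identity relates three signs: the side of the wall on which `s` lies, the orientation of `s`, and
the sign of the face in the boundary operator. -/
theorem det_cons_edgeVec_face (e : Module.Basis (Fin (n + 1)) ℝ E) (s : K.B.Cell (n + 1))
    (j : Fin (n + 2)) (w : E) :
    e.det (Matrix.vecCons w (K.edgeVec (K.B.face j s))) =
      (-1) ^ ((j : ℕ) + 1) * (baryDeriv s j w * e.det (K.edgeVec s)) := by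
  let L : E →ₗ[ℝ] ℝ :=
    { toFun := fun w => e.det (Matrix.vecCons w (K.edgeVec (K.B.face j s)))
      map_add' := fun x y => e.det.map_vecCons_add _ x y
      map_smul' := fun c x => e.det.map_vecCons_smul _ c x }
  let M : E →ₗ[ℝ] ℝ := ((-1) ^ ((j : ℕ) + 1) * e.det (K.edgeVec s)) • baryDeriv s j
  have hLM : L = M := by
    refine (edgeBasis s).ext fun i => ?_
    simp only [L, M, LinearMap.coe_mk, AddHom.coe_mk, LinearMap.smul_apply, smul_eq_mul,
      edgeBasis_apply]
    induction j using Fin.cases with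
    | zero =>
      have h1 : K.edgeVec (K.B.face 0 s) = fun l => K.edgeVec s l.succ - K.edgeVec s 0 :=
        funext fun l => edgeVec_face_zero s l
      rw [h1, det_cons_sub, baryDeriv_zero, ← edgeBasis_apply]
      simp [LinearMap.sum_apply, Finsupp.single_apply]
    | succ j =>
      have h1 : K.edgeVec (K.B.face j.succ s) = j.removeNth (K.edgeVec s) :=
        funext fun l => edgeVec_face_succ s j l
      have h2 := e.det.map_insertNth j (K.edgeVec s i) (j.removeNth (K.edgeVec s))
      rw [Fin.insertNth_removeNth] at h2
      have h3 : e.det (Matrix.vecCons (K.edgeVec s i) (j.removeNth (K.edgeVec s))) =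
          (-1) ^ (j : ℕ) * e.det (Function.update (K.edgeVec s) j (K.edgeVec s i)) := by
        rw [h2]
        rcases Nat.even_or_odd (j : ℕ) with h | h <;> simp [h.neg_one_pow]
      have h4 : (edgeBasis s).coord j (K.edgeVec s i) = if i = j then 1 else 0 := by
        rw [← edgeBasis_apply]
        simp [Finsupp.single_apply]
      rw [h1, h3, baryDeriv_succ, h4]
      rcases eq_or_ne i j with rfl | hij
      · simp [pow_succ]
      · rw [AlternatingMap.map_update_self _ _ hij.symm]
        simp [hij]
  have := LinearMap.congr_fun hLM w
  simp only [L, M, LinearMap.coe_mk, AddHom.coe_mk, LinearMap.smul_apply, smul_eq_mul] at this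
  rw [this]
  ring

/-- The sign of a real number, as a complex number. -/
def sgn (x : ℝ) : ℂ := ((x / |x| : ℝ) : ℂ)

theorem sgn_mul (x y : ℝ) : sgn (x * y) = sgn x * sgn y := by
  rw [sgn, abs_mul, mul_div_mul_comm, Complex.ofReal_mul]
  rfl

theorem sgn_neg_one_pow (n : ℕ) : sgn ((-1) ^ n) = (-1) ^ n := by
  simp [sgn]

/-- At `x = 0` the convention `0 / 0 = 0` agrees with the vanishing of both indicators. -/
theorem sgn_eq_ite (x : ℝ) : sgn x = (if 0 < x then 1 else 0) - (if 0 < -x then 1 else 0) := by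
  rcases lt_trichotomy x 0 with h | rfl | h
  · rw [sgn, abs_of_neg h, div_neg, div_self h.ne, if_neg h.not_gt, if_pos (neg_pos.2 h)]
    simp
  · simp [sgn]
  · rw [sgn, abs_of_pos h, div_self h.ne', if_pos h, if_neg (by linarith)]
    simp

theorem sgn_mul_self {x : ℝ} (h : x ≠ 0) : sgn x * sgn x = 1 := by
  rw [← sgn_mul, sgn, abs_of_nonneg (mul_self_nonneg x), div_self (mul_ne_zero h h),
    Complex.ofReal_one]

end Orientation

section Orient

variable {E : Type*} [NormedAddCommGroup E] [InnerProductSpace ℝ E] [FiniteDimensional ℝ E]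
  {d : ℕ} {K : FBSComplex.{u} E d}

/-- The determinant of the edge vectors of a top-dimensional cell. -/
def orient (s : K.B.Cell d) : ℝ :=
  (Module.finBasisOfFinrankEq ℝ E K.finrank_eq).det (K.edgeVec s)

theorem orient_ne_zero (s : K.B.Cell d) : orient s ≠ 0 := by
  have h := ((Module.finBasisOfFinrankEq ℝ E K.finrank_eq).isUnit_det (edgeBasis s)).ne_zero
  rwa [show ⇑(edgeBasis s) = K.edgeVec s from funext (edgeBasis_apply s)] at h

end Orient

end FBSComplex

/-! ### The cycle condition across walls -/

namespace FBSComplex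

open SemiSimplicialSet

variable {E : Type*} [NormedAddCommGroup E] [InnerProductSpace ℝ E] [FiniteDimensional ℝ E]

section Wall

variable {n : ℕ} {K : FBSComplex.{u} E (n + 1)}

instance fintypeCell {d : ℕ} (K : FBSComplex.{u} E d) (n : ℕ) : Fintype (K.B.Cell n) :=
  have := K.finite_cell n
  Fintype.ofFinite _

open Classical in
-- Representations of an interior point of `τ` in top-dimensional cells are the ways of being the
-- face opposite some vertex `j`. Only the `j`-th coordinate vanishes, so `w` points inwards exactly
-- when its derivative is positive.
theorem directed_point_wall (w : E) (τ : K.B.Cell n) {b : stdSimplex ℝ (Fin (n + 1))}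
    (hb : ∀ i, 0 < b i) :
    (finite_directed w (point τ b)).toFinset =
      (Finset.univ.filter fun q : K.B.Cell (n + 1) × Fin (n + 2) =>
        K.B.face q.2 q.1 = τ ∧ 0 < baryDeriv q.1 q.2 w).image
        fun q => (q.1, stdSimplex.map (Fin.succAboveOrderEmb q.2) b) := by
  ext ⟨s, t⟩
  simp only [Set.Finite.mem_toFinset, Finset.mem_image, Finset.mem_filter, Finset.mem_univ,
    true_and, Prod.exists, Prod.mk.injEq]
  constructor
  · rintro ⟨h, hw⟩
    obtain ⟨φ, h1, rfl⟩ := exists_map_eq_of_point_eq hb (Eq.symm h)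
    obtain ⟨j, rfl⟩ := exists_eq_succAboveOrderEmb φ
    exact ⟨s, j, ⟨h1, hw j (map_succAbove_self j b)⟩, rfl, rfl⟩
  · rintro ⟨s', j, ⟨h1, h2⟩, rfl, rfl⟩
    refine ⟨?_, fun i hi => ?_⟩
    · rw [← h1, face, point_pull]
    · dsimp only at hi
      rcases eq_or_ne i j with rfl | hij
      · exact h2
      · obtain ⟨l, rfl⟩ := Fin.exists_succAbove_eq hij
        rw [map_succAbove_succAbove] at hi
        exact absurd hi (hb l).ne'

/-- The deleted vertex is recovered as the only vanishing coordinate. A cell that has `τ` as several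
faces is therefore counted once for each of them. -/
theorem map_succAbove_injective {b : stdSimplex ℝ (Fin (n + 1))} (hb : ∀ i, 0 < b i) :
    Function.Injective fun j : Fin (n + 2) => stdSimplex.map (Fin.succAboveOrderEmb j) b := by
  intro i j hij
  by_contra hne
  obtain ⟨l, rfl⟩ := Fin.exists_succAbove_eq hne
  have h := map_succAbove_self (j.succAbove l) b
  dsimp only at hij
  rw [hij, map_succAbove_succAbove] at h
  exact (hb l).ne' h

variable [MeasurableSpace E] [BorelSpace E] {f₀ : C(E, K.Space)} {μ : Measure (Hull f₀)}
  [IsProbabilityMeasure μ] {k : E →L[ℝ] ℝ} {ψ : Lp ℂ 2 μ}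

open Classical in
theorem partialAmplitude_point_wall (w : E) (τ : K.B.Cell n) {b : stdSimplex ℝ (Fin (n + 1))}
    (hb : ∀ i, 0 < b i) : partialAmplitude k ψ w (point τ b) =
      ∑ s, ∑ j, if K.B.face j s = τ then amplitude k ψ s *
        (Complex.exp (-2 * Real.pi * Complex.I * (k (K.position τ b) : ℂ)) *
          Complex.exp (-2 * Real.pi * Complex.I * (k (K.faceShift s j) : ℂ))) *
        (if 0 < baryDeriv s j w then 1 else 0) else 0 := by
  rw [partialAmplitude, directed_point_wall w τ hb, Finset.sum_image, Finset.sum_filter,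
    ← Finset.univ_product_univ, Finset.sum_product]
  · refine Finset.sum_congr rfl fun s _ => Finset.sum_congr rfl fun j _ => ?_
    by_cases h1 : K.B.face j s = τ
    · by_cases h2 : 0 < baryDeriv s j w
      · rw [if_pos ⟨h1, h2⟩, if_pos h1, if_pos h2, mul_one, position_map_succAbove, h1,
          ← Complex.exp_add, map_add]
        congr 2
        push_cast
        ring
      · rw [if_neg fun h => h2 h.2, if_pos h1, if_neg h2, mul_zero]
    · rw [if_neg fun h => h1 h.1, if_neg h1]
  · rintro ⟨s, j⟩ - ⟨s', j'⟩ - h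
    obtain ⟨rfl, h2⟩ := Prod.mk.inj h
    exact Prod.ext rfl (map_succAbove_injective hb h2)

open Classical in
-- Subtracting the formulas for `w` and `-w` turns the indicators of the two sides into `sgn
-- (baryDeriv s j w)`. By the determinant identity this sign is `-(-1)^j sgn (orient s)` times the
-- sign of a determinant that depends only on `τ` and `w`, and that common factor cancels.
theorem sum_faces_eq_zero (hf₀ : IsTiled f₀)
    (hμ : ∀ t : E, MeasurePreserving (Hull.shift (f₀ := f₀) t) μ μ)
    (hψ : IsEigenfunction μ k ψ) (τ : K.B.Cell n) :
    ∑ s, ∑ j, (if K.B.face j s = τ then (-1) ^ (j : ℕ) *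
      Complex.exp (-2 * Real.pi * Complex.I * (k (K.faceShift s j) : ℂ)) *
        (sgn (orient s) * amplitude k ψ s) else 0) = 0 := by
  obtain ⟨w, hw⟩ := K.exists_isGeneric
  obtain ⟨b, hb⟩ := exists_stdSimplex_pos n
  have huniq := congrFun ((isPartialAmplitude_partialAmplitude hf₀ hμ hψ hw).unique
    (isPartialAmplitude_partialAmplitude hf₀ hμ hψ hw.neg)) (point τ b)
  rw [← sub_eq_zero, partialAmplitude_point_wall w τ hb, partialAmplitude_point_wall (-w) τ hb,
    ← Finset.sum_sub_distrib] at huniq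
  simp only [← Finset.sum_sub_distrib] at huniq
  set D := (Module.finBasisOfFinrankEq ℝ E K.finrank_eq).det
    (Matrix.vecCons w (K.edgeVec τ)) with hD
  set c := Complex.exp (-2 * Real.pi * Complex.I * (k (K.position τ b) : ℂ)) with hc
  have hterm (s : K.B.Cell (n + 1)) (j : Fin (n + 2)) (h : K.B.face j s = τ) :
      sgn (baryDeriv s j w) = -(sgn D * ((-1) ^ (j : ℕ) * sgn (orient s))) ∧ D ≠ 0 := by
    have h1 := det_cons_edgeVec_face (Module.finBasisOfFinrankEq ℝ E K.finrank_eq) s j w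
    rw [h, ← hD] at h1
    change D = _ * (_ * orient s) at h1
    refine ⟨?_, ?_⟩
    · rw [h1, sgn_mul, sgn_mul, sgn_neg_one_pow]
      have h2 := sgn_mul_self (orient_ne_zero s)
      have h3 : ((-1 : ℂ) ^ (j : ℕ)) * (-1) ^ (j : ℕ) = 1 := by
        rw [← mul_pow]
        simp
      rw [pow_succ]
      linear_combination (-sgn (baryDeriv s j w)) * h3 -
        (sgn (baryDeriv s j w) * ((-1 : ℂ) ^ (j : ℕ)) * (-1) ^ (j : ℕ)) * h2
    · rw [h1]
      exact mul_ne_zero (by simp) (mul_ne_zero (hw s j (Nat.succ_ne_zero n)) (orient_ne_zero s))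
  -- The common factor is known to be nonzero only if `τ` is a face of some top-dimensional cell.
  -- Otherwise every summand is zero.
  by_cases hex : ∃ s, ∃ j, K.B.face (n := n) j s = τ
  · obtain ⟨s₀, j₀, h₀⟩ := hex
    have hD0 := (hterm s₀ j₀ h₀).2
    have hprod : -(sgn D * c) * ∑ s, ∑ j, (if K.B.face j s = τ then (-1) ^ (j : ℕ) *
        Complex.exp (-2 * Real.pi * Complex.I * (k (K.faceShift s j) : ℂ)) *
        (sgn (orient s) * amplitude k ψ s) else 0) = 0 := by
      refine Eq.trans ?_ huniq
      simp only [Finset.mul_sum]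
      refine Finset.sum_congr rfl fun s _ => Finset.sum_congr rfl fun j _ => ?_
      by_cases h : K.B.face j s = τ
      · simp only [if_pos h]
        rw [← mul_sub, map_neg, ← sgn_eq_ite, (hterm s j h).1]
        ring
      · simp only [if_neg h, mul_zero, sub_zero]
    have hs : sgn D ≠ 0 := left_ne_zero_of_mul_eq_one (sgn_mul_self hD0)
    exact (mul_eq_zero.1 hprod).resolve_left
      (neg_ne_zero.2 (mul_ne_zero hs (Complex.exp_ne_zero _)))
  · push Not at hex
    exact Finset.sum_eq_zero fun s _ => Finset.sum_eq_zero fun j _ => if_neg (hex s j)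

end Wall

section Cycle

variable {d : ℕ} {K : FBSComplex.{u} E d}

/-- The coefficient of `Y_s`. -/
def coeff (k : E →L[ℝ] ℝ) {n : ℕ} (s : K.B.Cell n) : K.F k n →ₗ[ℂ] ℂ :=
  (Finsupp.lapply (R := ℂ) (M := ℂ) s : (K.B.Cell n →₀ ℂ) →ₗ[ℂ] ℂ)

open Classical in
theorem coeff_boundary {k : E →L[ℝ] ℝ} {n : ℕ} (z : K.F k (n + 1)) (τ : K.B.Cell n) :
    coeff k τ (K.boundary k n z) =
      ∑ s, ∑ j, (if K.B.face j s = τ then (-1) ^ (j : ℕ) *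
        Complex.exp (-2 * Real.pi * Complex.I * (k (K.faceShift s j) : ℂ)) * coeff k s z
        else 0) := by
  have hY (s : K.B.Cell n) : coeff k τ (K.Y k s) = if s = τ then 1 else 0 := Finsupp.single_apply
  have hf (j : Fin (n + 2)) : coeff k τ (K.faceF k n j z) = ∑ s, coeff k s z *
      (Complex.exp (-2 * Real.pi * Complex.I * (k (K.faceShift s j) : ℂ)) *
        if K.B.face j s = τ then 1 else 0) := by
    have h : K.faceF k n j z = ∑ s, coeff k s z •
        (Complex.exp (-2 * Real.pi * Complex.I * (k (K.faceShift s j) : ℂ)) •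
          K.Y k (K.B.face j s)) :=
      (Finsupp.linearCombination_apply ℂ _).trans (Finsupp.sum_fintype _ _ (by simp))
    rw [h, map_sum]
    simp only [map_smul, smul_eq_mul, hY]
  rw [boundary, LinearMap.sum_apply, map_sum]
  simp only [LinearMap.smul_apply, map_smul, hf, smul_eq_mul, Finset.mul_sum]
  rw [Finset.sum_comm]
  refine Finset.sum_congr rfl fun s _ => Finset.sum_congr rfl fun j _ => ?_
  split_ifs <;> ring

variable [MeasurableSpace E] [BorelSpace E] {f₀ : C(E, K.Space)} {μ : Measure (Hull f₀)}
  [IsProbabilityMeasure μ] {k : E →L[ℝ] ℝ} {ψ : Lp ℂ 2 μ}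

/-- The chain formed by the signed amplitudes of the tiles. -/
def amplitudeChain (k : E →L[ℝ] ℝ) (ψ : Lp ℂ 2 μ) : K.F k d :=
  Finsupp.equivFunOnFinite.symm fun s : K.B.Cell d => sgn (orient s) * amplitude k ψ s

theorem amplitudeChain_mem_cycles (hf₀ : IsTiled f₀)
    (hμ : ∀ t : E, MeasurePreserving (Hull.shift (f₀ := f₀) t) μ μ)
    (hψ : IsEigenfunction μ k ψ) : amplitudeChain k ψ ∈ K.cycles k d := by
  cases d with
  | zero => exact Submodule.mem_top
  | succ n =>
    change K.boundary k n _ = 0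
    refine Finsupp.ext fun τ => ?_
    exact (coeff_boundary _ τ).trans (sum_faces_eq_zero hf₀ hμ hψ τ)

/-- The linear map that computes the partial amplitudes at the sites `x` from the signed
amplitudes of the tiles. -/
def siteMap (K : FBSComplex.{u} E d) (k : E →L[ℝ] ℝ) (w : E) {m : ℕ} (x : Fin m → K.Space) :
    K.F k d →ₗ[ℂ] Fin m → ℂ :=
  LinearMap.pi fun p => ∑ q ∈ (finite_directed w (x p)).toFinset,
    (sgn (orient q.1) * Complex.exp (-2 * Real.pi * Complex.I * (k (K.position q.1 q.2) : ℂ))) •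
      coeff k q.1

/-- The orientation sign occurs in the chain and again in the map, and its square is `1`. -/
theorem siteMap_amplitudeChain (w : E) {m : ℕ} (x : Fin m → K.Space) (p : Fin m) :
    siteMap K k w x (amplitudeChain k ψ) p = partialAmplitude k ψ w (x p) := by
  rw [siteMap, LinearMap.pi_apply, LinearMap.sum_apply, partialAmplitude]
  refine Finset.sum_congr rfl fun q _ => ?_
  have h : coeff k q.1 (amplitudeChain k ψ) = sgn (orient q.1) * amplitude k ψ q.1 := rfl
  rw [LinearMap.smul_apply, h, smul_eq_mul]
  linear_combination (Complex.exp (-2 * Real.pi * Complex.I * (k (K.position q.1 q.2) : ℂ)) *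
    amplitude k ψ q.1) * sgn_mul_self (orient_ne_zero q.1)

end Cycle

/-! ### Top homology, linear constraints and the conclusion -/

section Homology

variable {d : ℕ} (K : FBSComplex.{u} E d) (k : E →L[ℝ] ℝ)

instance finite_F (n : ℕ) : Module.Finite ℂ (K.F k n) :=
  inferInstanceAs (Module.Finite ℂ (K.B.Cell n →₀ ℂ))

/-- In top degree the homology is the space of cycles. -/
theorem finrank_homology_top :
    Module.finrank ℂ (K.Homology k d) = Module.finrank ℂ (K.cycles k d) := by
  have := K.isEmpty_cell (d + 1) (Nat.lt_succ_self d)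
  have h : (LinearMap.range (K.boundary k d)).submoduleOf (K.cycles k d) = ⊥ := by
    have hsub : Subsingleton (K.F k (d + 1)) :=
      inferInstanceAs (Subsingleton (K.B.Cell (d + 1) →₀ ℂ))
    have h0 : K.boundary k d = 0 := Subsingleton.elim _ _
    rw [h0, LinearMap.range_zero, Submodule.submoduleOf, Submodule.comap_bot,
      Submodule.ker_subtype]
  exact (Submodule.quotEquivOfEqBot _ h).finrank_eq

end Homology

/-- A subspace of `ℂ ^ m` of dimension at most `r` satisfies `m - r` independent linear
constraints. -/
theorem exists_linearIndependent_constraints {m r : ℕ} (V : Submodule ℂ (Fin m → ℂ))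
    (hV : Module.finrank ℂ V ≤ r) :
    ∃ c : Fin (m - r) → Fin m → ℂ, LinearIndependent ℂ c ∧ ∀ v ∈ V, ∀ j, ∑ p, c j p * v p = 0 := by
  have h1 := Subspace.finrank_add_finrank_dualAnnihilator_eq V
  rw [Module.finrank_fin_fun] at h1
  have hle : m - r ≤ Module.finrank ℂ V.dualAnnihilator := by omega
  -- Evaluation on the standard basis turns independent functionals in the annihilator into
  -- independent coefficient vectors.
  let e : Module.Dual ℂ (Fin m → ℂ) →ₗ[ℂ] (Fin m → ℂ) :=
    LinearMap.pi fun p => LinearMap.applyₗ (Pi.single p 1)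
  have he : LinearMap.ker e = ⊥ := by
    refine LinearMap.ker_eq_bot'.2 fun f hf => LinearMap.pi_ext' fun p => LinearMap.ext_ring ?_
    exact congrFun hf p
  let c' : Fin (m - r) → Module.Dual ℂ (Fin m → ℂ) :=
    fun j => (Module.finBasis ℂ V.dualAnnihilator (Fin.castLE hle j)).1
  have hc' : LinearIndependent ℂ c' :=
    ((Module.finBasis ℂ V.dualAnnihilator).linearIndependent.comp _
      (Fin.castLE_injective hle)).map' V.dualAnnihilator.subtype (Submodule.ker_subtype _)
  refine ⟨fun j => e (c' j), hc'.map' e he, fun v hv j => ?_⟩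
  have h2 : c' j v = 0 := (Submodule.mem_dualAnnihilator _).1
    (Module.finBasis ℂ V.dualAnnihilator (Fin.castLE hle j)).2 v hv
  rw [← h2, LinearMap.pi_apply_eq_sum_univ (c' j) v]
  refine Finset.sum_congr rfl fun p _ => ?_
  rw [smul_eq_mul, mul_comm]
  congr 1
  change c' j (Pi.single p 1) = _
  congr 1
  ext q
  simp [Pi.single_apply, eq_comm]

end FBSComplex

theorem mainTheorem8 {E : Type*} [NormedAddCommGroup E] [InnerProductSpace ℝ E]
    [FiniteDimensional ℝ E] [MeasurableSpace E] [BorelSpace E] {d : ℕ}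
    (K : FBSComplex.{u} E d) (k : E →L[ℝ] ℝ) (m : ℕ) (x : Fin m → K.Space) :
    ∃ c : Fin (m - Module.finrank ℂ (K.Homology k d)) → (Fin m → ℂ),
      LinearIndependent ℂ c ∧
      ∀ f₀ : C(E, K.Space), K.IsIsometricWinding f₀ →
      ∀ μ : Measure (FBSComplex.Hull f₀), IsProbabilityMeasure μ →
        (∀ t : E, MeasurePreserving (FBSComplex.Hull.shift t) μ μ) →
      ∀ ψ : Lp ℂ 2 μ, FBSComplex.IsEigenfunction μ k ψ →
        (∃! a : K.Space → ℂ, FBSComplex.IsPartialAmplitude μ k ψ a) ∧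
        ∀ a : K.Space → ℂ, FBSComplex.IsPartialAmplitude μ k ψ a →
          ∀ j, ∑ p, c j p * a (x p) = 0 := by
  -- The direction is chosen from `K` alone, before any winding, measure or eigenfunction, so the
  -- constraints do not depend on these.
  obtain ⟨w, hw⟩ := K.exists_isGeneric
  obtain ⟨c, hc, hcV⟩ := FBSComplex.exists_linearIndependent_constraints
    (r := Module.finrank ℂ (K.Homology k d))
    ((K.cycles k d).map (FBSComplex.siteMap K k w x))
    (by rw [K.finrank_homology_top]; exact Submodule.finrank_map_le _ _)
  refine ⟨c, hc, fun f₀ hf₀ μ _ hμ ψ hψ => ?_⟩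
  have ha := FBSComplex.isPartialAmplitude_partialAmplitude hf₀.isTiled hμ hψ hw
  refine ⟨⟨_, ha, fun a' ha' => ha'.unique ha⟩, fun a' ha' j => ?_⟩
  rw [ha'.unique ha, ← hcV _ (Submodule.mem_map_of_mem
    (FBSComplex.amplitudeChain_mem_cycles hf₀.isTiled hμ hψ)) j]
  simp only [FBSComplex.siteMap_amplitudeChain]

end
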